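/- Let $d\ge 1$ be an integer, let $\mathbb{R}^d$ carry Lebesgue measure, and let $F\in W^{1,\infty}(\mathbb{R}^d;\mathbb{R}^d)$ be a force field $F=F(x)$, that is, $F$ and all its first-order weak partial derivatives belong to $L^\infty$. A family $(h_\epsilon)$ of functions in $L^1_{loc}(\mathbb{R}^d\times\mathbb{R}^d)$ is called bounded in $L^1_{loc}(dx\otimes dv)$ if $\sup_\epsilon\int_K|h_\epsilon|\,dx\,dv<\infty$ for every compact $K\subset\mathbb{R}^d\times\mathbb{R}^d$. A bounded family $(f_\epsilon)$ of $L^1_{loc}(dx\otimes dv)$ is called locally equiintegrable in $x$ and $v$ if for every $\eta>0$ and every compact $K\subset\mathbb{R}^d\times\mathbb{R}^d$ there is $\alpha>0$ such that, for every measurable $A\subset\mathbb{R}^d\times\mathbb{R}^d$ with $|A|<\alpha$ and every $\epsilon$, $$\int_A \mathbf 1_K(x,v)\,|f_\epsilon(x,v)|\,dv\,dx\le\eta .$$ Theorem. Let $(f_\epsilon)$ be a family (over an arbitrary index set) of real-valued functions in $L^1_{loc}(dx\otimes dv)$ that is locally equiintegrable in $x$ and $v$, and suppose that the distributions $v\cdot\nabla_x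 f_\epsilon+F\cdot\nabla_v f_\epsilon$ form a bounded family of $L^1_{loc}(dx\otimes dv)$; that is, there is a bounded family $(g_\epsilon)$ of $L^1_{loc}(dx\otimes dv)$ such that for every $\epsilon$ and every $\varphi\in C_c^\infty(\mathbb{R}^d\times\mathbb{R}^d)$ $$\int f_\epsilon\,\bigl(v\cdot\nabla_x\varphi+F(x)\cdot\nabla_v\varphi\bigr)\,dx\,dv=-\int g_\epsilon\,\varphi\,dx\,dv .$$ Then for every $\Psi\in C^1_c(\mathbb{R}^d)$ the moments $\rho_\epsilon(x)=\int_{\mathbb{R}^d} f_\epsilon(x,v)\Psi(v)\,dv$ belong to $L^1_{loc}(dx)$ and the family $(\rho_\epsilon)$ is relatively compact in $L^1_{loc}(dx)$, i.e. its closure is compact for the topology of $L^1$ convergence on compact subsets of $\mathbb{R}^d$. -/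

import Mathlib

open MeasureTheory Set TopologicalSpace
open scoped ContDiff ENNReal

noncomputable section

namespace KineticAveraging

/-- The space `ℝ^d` with its Euclidean norm and Lebesgue measure. -/
abbrev E (d : ℕ) : Type := EuclideanSpace ℝ (Fin d)

/-- Smooth compactly supported real test functions. -/
def IsTestFunction {X : Type*} [NormedAddCommGroup X] [NormedSpace ℝ X] (φ : X → ℝ) : Prop :=
  ContDiff ℝ ∞ φ ∧ HasCompactSupport φ

/-- `G` is the weak partial derivative `∂F/∂x_j` of the vector field `F`. -/
def HasWeakPartialDeriv {d : ℕ} (j : Fin d) (F G : E d → E d) : Prop :=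
  ∀ φ : E d → ℝ, IsTestFunction φ →
    ∫ x, fderiv ℝ φ x (EuclideanSpace.single j 1) • F x = -∫ x, φ x • G x

/-- `F ∈ W^{1,∞}(ℝ^d; ℝ^d)`: `F` and all its first-order weak partial derivatives are in `L^∞`. -/
def MemW1Infty {d : ℕ} (F : E d → E d) : Prop :=
  MemLp F ∞ volume ∧
    ∀ j : Fin d, ∃ G : E d → E d, MemLp G ∞ volume ∧ HasWeakPartialDeriv j F G

/-- A bounded family of `L^1_loc(dx ⊗ dv)`. -/
def BoundedInL1loc {d : ℕ} {ι : Type*} (f : ι → E d × E d → ℝ) : Prop :=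
  (∀ i, LocallyIntegrable (f i) volume) ∧
    ∀ K : Set (E d × E d), IsCompact K → ∃ C : ℝ, ∀ i, ∫ z in K, |f i z| ≤ C

/-- Local equiintegrability in `x` and `v` of a (by definition bounded) family of
`L^1_loc(dx ⊗ dv)`. -/
def LocallyEquiintegrable {d : ℕ} {ι : Type*} (f : ι → E d × E d → ℝ) : Prop :=
  BoundedInL1loc f ∧
    ∀ η : ℝ, 0 < η → ∀ K : Set (E d × E d), IsCompact K →
      ∃ α : ℝ, 0 < α ∧ ∀ A : Set (E d × E d), MeasurableSet A → volume A < ENNReal.ofReal α →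
        ∀ i, ∫ z in A, K.indicator (fun z => |f i z|) z ≤ η

/-- `v · ∇_x f + F · ∇_v f = g` in the sense of distributions. Since `F` depends on `x` only, the
transport field `(v, F(x))` is divergence free, so its formal adjoint is its opposite;
`fderiv ℝ φ z (z.2, F z.1)` is `v · ∇_x φ + F(x) · ∇_v φ` at `z = (x, v)`. -/
def HasWeakTransport {d : ℕ} (F : E d → E d) (f g : E d × E d → ℝ) : Prop :=
  ∀ φ : E d × E d → ℝ, IsTestFunction φ →
    ∫ z, f z * fderiv ℝ φ z (z.2, F z.1) = -∫ z, g z * φ z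

/-- The moment `ρ(x) = ∫ f(x, v) Ψ(v) dv`. -/
def moment {d : ℕ} (f : E d × E d → ℝ) (Ψ : E d → ℝ) (x : E d) : ℝ :=
  ∫ v, f (x, v) * Ψ v

/-- The space `L^1_loc(dx)` of almost-everywhere classes of locally integrable functions. -/
def L1loc (d : ℕ) : Type :=
  {u : E d →ₘ[volume] ℝ // LocallyIntegrable u volume}

/-- The class in `L^1_loc` of a locally integrable function. -/
def L1loc.mk {d : ℕ} (u : E d → ℝ) (hu : LocallyIntegrable u volume) : L1loc d :=
  ⟨AEEqFun.mk u hu.aestronglyMeasurable,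
    (locallyIntegrable_congr (AEEqFun.coeFn_mk u hu.aestronglyMeasurable)).2 hu⟩

/-- Restriction of an element of `L^1_loc` to a compact set `K`, as an element of `L^1(K)`. -/
def L1loc.restrict {d : ℕ} (K : Compacts (E d)) (u : L1loc d) :
    Lp ℝ 1 (volume.restrict (K : Set (E d))) :=
  (u.2.integrableOn_isCompact K.isCompact).toL1 u.1

/-- The usual (Fréchet) topology of `L^1_loc`: the coarsest one for which all the restriction maps
to `L^1(K)`, `K` compact, are continuous; convergence is `L^1` convergence on compact sets. -/
instance L1loc.instTopologicalSpace (d : ℕ) : TopologicalSpace (L1loc d) :=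
  ⨅ K : Compacts (E d), TopologicalSpace.induced (L1loc.restrict K) inferInstance

end KineticAveraging

end

open MeasureTheory Set TopologicalSpace
open scoped ContDiff ENNReal

noncomputable section

namespace KineticAveraging

/-! For `s ≠ 0` the point `x + s v` moves with `v`, so integrating in `v` smears oscillations in
`x`; the bound on the transport term controls the price of replacing `x` by `x + s v`. That term is
controlled only in `L¹`, so the argument runs by duality against bounded functions of `x`.

Reduction to bounded functions. `F` is a.e. equal to a Lipschitz field, so mollifying `f i` in phase
space costs only a commutator bounded in `L¹_loc`. A smooth truncation of slope at most one keeps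
the transport bound, and equiintegrability makes its error uniformly small. Hence each `f i` is
`L¹`-close on a ball to a `C¹` function `u` with `|u| ≤ M` and transport term at most `G` in `L¹`,
with `M` and `G` independent of `i` (`exists_bounded_approximation`).

Core estimate. Let `D` be the difference of the mollifications of some `|h| ≤ 1` at two successive
radii, the larger being `r`. In `∫ u θ D(x)` one may replace `D(x)` by `D(x + s v)` with error of
order `s + s² ‖∇D‖`, the second term coming from the force (`exists_bound_free_transport`). For
distinct times `s`, `t` the functions `D(x + s v)` and `D(x + t v)` are almost orthogonal, with
correlation of order `r / |t - s|`, so their average over many times is small in weighted `L²`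
(`integral_mul_sq_average_le`), and `|u| ≤ M` concludes. A suitable choice of scales gives a
geometric bound uniform in `h` (`exists_bound_dyadic`).

Summing over the radii and choosing `h` as a sign shows that `∫ u θ dv` is `L¹`-close to its
mollification at one fixed radius, which is bounded and Lipschitz uniformly in `u`
(`exists_lipschitz_approximation`). An Arzelà–Ascoli argument gives total boundedness in every
`L¹(K)`, and gluing limits over `K` gives compactness in `L1loc`. -/

open Filter Metric
open scoped Topology NNReal

/-! ### Mollification by averaged translates. -/

section Mollify

set_option linter.unusedSectionVars false

variable {V : Type*} [NormedAddCommGroup V] [NormedSpace ℝ V] [FiniteDimensional ℝ V]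
  [MeasurableSpace V] [BorelSpace V] {μ : Measure V} [μ.IsAddHaarMeasure]

/-- A smooth compactly supported probability density. -/
structure IsMollifier (μ : Measure V) (η : V → ℝ) : Prop where
  contDiff : ContDiff ℝ ∞ η
  hasCompactSupport : HasCompactSupport η
  nonneg : ∀ z, 0 ≤ η z
  integral_eq_one : ∫ z, η z ∂μ = 1

/-- The average of the translates `h (x - r z)` against the density `η`. -/
def mollify (μ : Measure V) (η : V → ℝ) (r : ℝ) (h : V → ℝ) (x : V) : ℝ :=
  ∫ z, η z * h (x - r • z) ∂μ

theorem exists_isMollifier (μ : Measure V) [μ.IsAddHaarMeasure] : ∃ η : V → ℝ, IsMollifier μ η := by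
  let φ : ContDiffBump (0 : V) := ⟨1, 2, zero_lt_one, one_lt_two⟩
  exact ⟨φ.normed μ, φ.contDiff_normed, φ.hasCompactSupport_normed, φ.nonneg_normed,
    φ.integral_normed⟩

theorem exists_radius_of_hasCompactSupport {f : V → ℝ} (hf : HasCompactSupport f) :
    ∃ R : ℝ, 0 < R ∧ ∀ z, R < ‖z‖ → f z = 0 := by
  obtain ⟨R, hR⟩ := hf.isCompact.isBounded.subset_closedBall (0 : V)
  refine ⟨max R 1, by positivity, fun z hz => ?_⟩
  by_contra h
  have := hR (subset_tsupport f h)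
  rw [mem_closedBall_zero_iff] at this
  exact absurd (this.trans (le_max_left R 1)) (not_le.2 hz)

theorem IsMollifier.integrable {η : V → ℝ} (hη : IsMollifier μ η) : Integrable η μ :=
  hη.contDiff.continuous.integrable_of_hasCompactSupport hη.hasCompactSupport

/-- The integrand lives on two balls of radius `R` and is at most `L * ‖a‖` there. This `L¹` modulus
of continuity is used whenever a shift is transferred from a rough factor to a Lipschitz one. -/
theorem integral_abs_translate_sub_le {κ : V → ℝ} {L : ℝ≥0} (hκ : LipschitzWith L κ) {R : ℝ}
    (hR : ∀ z, R < ‖z‖ → κ z = 0) (a : V) :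
    Integrable (fun v => |κ (v + a) - κ v|) μ ∧
    ∫ v, |κ (v + a) - κ v| ∂μ ≤ 2 * L * ‖a‖ * μ.real (closedBall 0 R) := by
  set S : Set V := closedBall 0 R ∪ closedBall (-a) R
  have hS : IsCompact S := (isCompact_closedBall _ _).union (isCompact_closedBall _ _)
  have hzero : ∀ v, v ∉ S → |κ (v + a) - κ v| = 0 := by
    intro v hv
    simp only [S, mem_union, mem_closedBall, not_or, not_le, dist_eq_norm, sub_neg_eq_add,
      sub_zero] at hv
    rw [hR _ hv.1, hR _ hv.2, sub_self, abs_zero]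
  have hcont : Continuous fun v => |κ (v + a) - κ v| :=
    ((hκ.continuous.comp (continuous_id.add continuous_const)).sub hκ.continuous).abs
  have hint : Integrable (fun v => |κ (v + a) - κ v|) μ :=
    hcont.integrable_of_hasCompactSupport (HasCompactSupport.intro hS hzero)
  refine ⟨hint, ?_⟩
  have hSfin : μ S ≠ ⊤ := hS.measure_lt_top.ne
  calc ∫ v, |κ (v + a) - κ v| ∂μ = ∫ v in S, |κ (v + a) - κ v| ∂μ :=
        (setIntegral_eq_integral_of_forall_compl_eq_zero hzero).symm
    _ ≤ ∫ v in S, (L * ‖a‖ : ℝ) ∂μ := by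
        refine setIntegral_mono hint.integrableOn (integrableOn_const hSfin) fun v => ?_
        have := hκ.dist_le_mul (v + a) v
        simpa [Real.dist_eq, dist_eq_norm] using this
    _ = μ.real S * (L * ‖a‖) := by rw [setIntegral_const, smul_eq_mul]
    _ ≤ (2 * μ.real (closedBall 0 R)) * (L * ‖a‖) := by
        gcongr
        refine (measureReal_union_le _ _).trans ?_
        rw [Measure.addHaar_real_closedBall_center μ (-a) R]
        linarith
    _ = _ := by ring

section Bounded

variable {η : V → ℝ} {h : V → ℝ}

theorem IsMollifier.integrable_mul_comp (hη : IsMollifier μ η) (hm : Measurable h)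
    (hb : ∀ x, |h x| ≤ 1) (x : V) (r : ℝ) :
    Integrable (fun z => η z * h (x - r • z)) μ := by
  refine hη.integrable.mul_bdd (c := 1) ?_ (Eventually.of_forall fun z => hb _)
  exact (hm.comp (by fun_prop)).aestronglyMeasurable

theorem IsMollifier.abs_mollify_le (hη : IsMollifier μ η) (hm : Measurable h)
    (hb : ∀ x, |h x| ≤ 1) (r : ℝ) (x : V) : |mollify μ η r h x| ≤ 1 := by
  calc |mollify μ η r h x| ≤ ∫ z, |η z * h (x - r • z)| ∂μ := abs_integral_le_integral_abs
    _ ≤ ∫ z, η z ∂μ := by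
        refine integral_mono (hη.integrable_mul_comp hm hb x r).abs hη.integrable fun z => ?_
        simp only [abs_mul, abs_of_nonneg (hη.nonneg z)]
        exact mul_le_of_le_one_right (hη.nonneg z) (hb _)
    _ = 1 := hη.integral_eq_one

/-- Moving from `x` to `y` amounts to translating `η` by `(x - y) / r`, so the regularity of `η`
replaces that of `h`. Negative radii are allowed because transposition produces them. -/
theorem IsMollifier.abs_mollify_sub_le (hη : IsMollifier μ η) (hm : Measurable h)
    (hb : ∀ x, |h x| ≤ 1) {L : ℝ≥0} (hL : LipschitzWith L η) {R : ℝ}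
    (hR : ∀ z, R < ‖z‖ → η z = 0) {r : ℝ} (hr : r ≠ 0) (x y : V) :
    |mollify μ η r h x - mollify μ η r h y| ≤
      2 * L * μ.real (closedBall 0 R) / |r| * ‖x - y‖ := by
  set a : V := r⁻¹ • (x - y)
  have hx : mollify μ η r h x = ∫ z, η (z + a) * h (y - r • z) ∂μ := by
    rw [mollify, ← integral_add_right_eq_self _ a]
    refine integral_congr_ae (Eventually.of_forall fun z => ?_)
    simp only [a, smul_add, smul_inv_smul₀ hr]
    congr 2
    abel
  have hi := hη.integrable_mul_comp hm hb y r
  obtain ⟨hai, hab⟩ := integral_abs_translate_sub_le (μ := μ) hL hR a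
  have hd : Integrable (fun z => (η (z + a) - η z) * h (y - r • z)) μ := by
    refine Integrable.mul_bdd (c := 1) ((hη.integrable.comp_add_right a).sub hη.integrable) ?_
      (Eventually.of_forall fun z => hb _)
    exact (hm.comp (by fun_prop)).aestronglyMeasurable
  have hi' : Integrable (fun z => η (z + a) * h (y - r • z)) μ := by
    refine (hd.add hi).congr (Eventually.of_forall fun z => ?_)
    simp only [Pi.add_apply]
    ring
  have hsub : mollify μ η r h x - mollify μ η r h y =
      ∫ z, (η (z + a) - η z) * h (y - r • z) ∂μ := by
    rw [hx, mollify, ← integral_sub hi' hi]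
    simp only [sub_mul]
  rw [hsub]
  calc |∫ z, (η (z + a) - η z) * h (y - r • z) ∂μ|
      ≤ ∫ z, |(η (z + a) - η z) * h (y - r • z)| ∂μ := abs_integral_le_integral_abs
    _ ≤ ∫ z, |η (z + a) - η z| ∂μ := by
        refine integral_mono hd.abs hai fun z => ?_
        simp only [abs_mul]
        exact mul_le_of_le_one_right (abs_nonneg _) (hb _)
    _ ≤ 2 * L * ‖a‖ * μ.real (closedBall 0 R) := hab
    _ = _ := by
        simp only [a, norm_smul, norm_inv, Real.norm_eq_abs]
        ring

/-- Since `y + σ v - r z = y + σ (v - (r / σ) z)`, a shift in space is a shift of size `r / |σ|` in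
velocity, which the Lipschitz weight `κ` absorbs. No regularity of `h` enters: this is the
nondegeneracy behind velocity averaging. -/
theorem IsMollifier.abs_integral_mul_mollify_sub_le (hη : IsMollifier μ η) (hm : Measurable h)
    (hb : ∀ x, |h x| ≤ 1) {Rη : ℝ} (hRη : ∀ z, Rη < ‖z‖ → η z = 0)
    {κ : V → ℝ} {L : ℝ≥0} (hκ : LipschitzWith L κ) {R : ℝ}
    (hR : ∀ z, R < ‖z‖ → κ z = 0) (r : ℝ) {σ : ℝ} (hσ : σ ≠ 0) (y : V) :
    |∫ v, κ v * mollify μ η r h (y + σ • v) ∂μ - ∫ v, κ v * h (y + σ • v) ∂μ| ≤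
      2 * L * μ.real (closedBall 0 R) * Rη * |r| / |σ| := by
  have hκc : HasCompactSupport κ := HasCompactSupport.intro (isCompact_closedBall (0 : V) R)
    fun z hz => hR z (by simpa using hz)
  have hκi : Integrable κ μ := hκ.continuous.integrable_of_hasCompactSupport hκc
  have hprod : Integrable (fun p : V × V => κ p.1 * (η p.2 * h (y + σ • p.1 - r • p.2)))
      (μ.prod μ) := by
    have : Integrable (fun p : V × V => κ p.1 * η p.2) (μ.prod μ) := hκi.mul_prod hη.integrable
    refine (this.mul_bdd (c := 1) (g := fun p : V × V => h (y + σ • p.1 - r • p.2)) ?_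
      (Eventually.of_forall fun z => hb _)).congr
      (Eventually.of_forall fun p => by simp only [mul_assoc])
    exact (hm.comp (by fun_prop)).aestronglyMeasurable
  have h1 : ∫ v, κ v * mollify μ η r h (y + σ • v) ∂μ =
      ∫ z, η z * ∫ v, κ (v + (r / σ) • z) * h (y + σ • v) ∂μ ∂μ := by
    simp only [mollify, ← integral_const_mul]
    rw [integral_integral_swap hprod]
    refine integral_congr_ae (Eventually.of_forall fun z => ?_)
    simp only
    rw [← integral_add_right_eq_self _ ((r / σ) • z)]
    refine integral_congr_ae (Eventually.of_forall fun v => ?_)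
    simp only [smul_add, smul_smul, mul_div_cancel₀ r hσ]
    rw [← add_assoc, add_sub_cancel_right]
    ring
  have h2 : ∫ v, κ v * h (y + σ • v) ∂μ = ∫ z, η z * ∫ v, κ v * h (y + σ • v) ∂μ ∂μ := by
    rw [integral_mul_const, hη.integral_eq_one, one_mul]
  have hih : ∀ a : V, Integrable (fun v => κ (v + a) * h (y + σ • v)) μ := fun a =>
    (hκi.comp_add_right a).mul_bdd (c := 1) (hm.comp (by fun_prop)).aestronglyMeasurable
      (Eventually.of_forall fun z => hb _)
  have hih0 : Integrable (fun v => κ v * h (y + σ • v)) μ := by simpa using hih 0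
  have hbound : ∀ a : V, |∫ v, κ (v + a) * h (y + σ • v) ∂μ - ∫ v, κ v * h (y + σ • v) ∂μ| ≤
      2 * L * ‖a‖ * μ.real (closedBall 0 R) := by
    intro a
    obtain ⟨hai, hab⟩ := integral_abs_translate_sub_le (μ := μ) hκ hR a
    rw [← integral_sub (hih a) hih0]
    refine abs_integral_le_integral_abs.trans (le_trans ?_ hab)
    refine integral_mono ((hih a).sub hih0).abs hai fun v => ?_
    simp only [← sub_mul, abs_mul]
    exact mul_le_of_le_one_right (abs_nonneg _) (hb _)
  have hint1 : Integrable (fun z => η z * ∫ v, κ (v + (r / σ) • z) * h (y + σ • v) ∂μ) μ := by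
    have := hprod.integral_prod_right
    refine this.congr (Eventually.of_forall fun z => ?_)
    simp only
    rw [← integral_add_right_eq_self _ ((r / σ) • z), ← integral_const_mul]
    refine integral_congr_ae (Eventually.of_forall fun v => ?_)
    simp only [smul_add, smul_smul, mul_div_cancel₀ r hσ]
    rw [← add_assoc, add_sub_cancel_right]
    ring
  rw [h1, h2, ← integral_sub hint1 (hη.integrable.mul_const _)]
  calc |∫ z, (η z * ∫ v, κ (v + (r / σ) • z) * h (y + σ • v) ∂μ) -
        η z * ∫ v, κ v * h (y + σ • v) ∂μ ∂μ|
      ≤ ∫ z, η z * (2 * L * μ.real (closedBall 0 R) * Rη * |r| / |σ|) ∂μ := by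
        rw [← Real.norm_eq_abs]
        refine norm_integral_le_of_norm_le (hη.integrable.mul_const _)
          (Eventually.of_forall fun z => ?_)
        rw [← mul_sub, norm_mul, Real.norm_of_nonneg (hη.nonneg z), Real.norm_eq_abs]
        by_cases hz : Rη < ‖z‖
        · simp [hRη z hz]
        · refine mul_le_mul_of_nonneg_left ((hbound _).trans ?_) (hη.nonneg z)
          rw [norm_smul, Real.norm_eq_abs, abs_div]
          have : 2 * L * (|r| / |σ| * ‖z‖) * μ.real (closedBall 0 R) ≤
              2 * L * (|r| / |σ| * Rη) * μ.real (closedBall 0 R) := by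
            gcongr
            exact not_lt.1 hz
          refine this.trans_eq ?_
          ring
    _ = _ := by rw [integral_mul_const, hη.integral_eq_one, one_mul]

/-- Transposition reverses the translations, hence the radius `-r`; `η` is not assumed even. -/
theorem IsMollifier.integral_mul_mollify (hη : IsMollifier μ η) (hm : Measurable h)
    (hb : ∀ x, |h x| ≤ 1) {w : V → ℝ} (hw : Integrable w μ) (hwm : Measurable w)
    (r : ℝ) :
    ∫ x, w x * mollify μ η r h x ∂μ = ∫ x, mollify μ η (-r) w x * h x ∂μ := by
  have hprod : Integrable (fun p : V × V => w p.1 * (η p.2 * h (p.1 - r • p.2))) (μ.prod μ) := by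
    refine ((hw.mul_prod hη.integrable).mul_bdd (c := 1)
      (g := fun p : V × V => h (p.1 - r • p.2)) ?_
      (Eventually.of_forall fun z => hb _)).congr
      (Eventually.of_forall fun p => by simp only [mul_assoc])
    exact (hm.comp (by fun_prop)).aestronglyMeasurable
  have hprod' : Integrable (fun p : V × V => η p.1 * w (p.2 + r • p.1) * h p.2) (μ.prod μ) := by
    have h0 : Integrable (fun p : V × V => η p.1 * w (p.2 + r • p.1)) (μ.prod μ) := by
      have hms : AEStronglyMeasurable (fun p : V × V => η p.1 * w (p.2 + r • p.1)) (μ.prod μ) :=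
        (((hη.contDiff.continuous.measurable.comp measurable_fst)).mul
          (hwm.comp (by fun_prop))).aestronglyMeasurable
      refine (integrable_prod_iff hms).2 ⟨Eventually.of_forall fun z =>
        (hw.comp_add_right (r • z)).const_mul (η z), ?_⟩
      simp only [norm_mul, integral_const_mul]
      refine (hη.integrable.norm.mul_const (∫ x, ‖w x‖ ∂μ)).congr
        (Eventually.of_forall fun z => ?_)
      simp only
      rw [integral_add_right_eq_self (fun x => ‖w x‖)]
    exact h0.mul_bdd (c := 1) (hm.comp measurable_snd).aestronglyMeasurable
      (Eventually.of_forall fun z => hb _)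
  simp only [mollify, ← integral_const_mul, ← integral_mul_const, neg_smul, sub_neg_eq_add]
  rw [integral_integral_swap hprod, ← integral_integral_swap
    (f := fun z x => η z * w (x + r • z) * h x) hprod']
  refine integral_congr_ae (Eventually.of_forall fun z => ?_)
  simp only
  rw [← integral_add_right_eq_self _ (r • z)]
  refine integral_congr_ae (Eventually.of_forall fun x => ?_)
  simp only [add_sub_cancel_right]
  ring

end Bounded

theorem mollify_eq_integral_kernel (η : V → ℝ) {r : ℝ} (hr : 0 < r) (f : V → ℝ) (x : V) :
    mollify μ η r f x =
      ∫ y, (r ^ Module.finrank ℝ V)⁻¹ * η (r⁻¹ • (x - y)) * f y ∂μ := by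
  have h := Measure.integral_comp_smul μ (fun w => η (r⁻¹ • w) * f (x - w)) r
  simp only [inv_smul_smul₀ hr.ne'] at h
  rw [mollify, h, abs_of_nonneg (by positivity), smul_eq_mul, ← integral_const_mul,
    ← integral_sub_left_eq_self _ μ x]
  refine integral_congr_ae (Eventually.of_forall fun y => ?_)
  simp only [sub_sub_cancel]
  ring

open scoped Convolution in
theorem IsMollifier.contDiff_mollify {η : V → ℝ} (hη : IsMollifier μ η) {r : ℝ} (hr : 0 < r)
    {f : V → ℝ} (hf : LocallyIntegrable f μ) : ContDiff ℝ ∞ (mollify μ η r f) := by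
  set k : V → ℝ := fun w => (r ^ Module.finrank ℝ V)⁻¹ * η (r⁻¹ • w)
  have hk : ContDiff ℝ ∞ k := contDiff_const.mul (hη.contDiff.comp (contDiff_const.smul contDiff_id))
  have hkc : HasCompactSupport k :=
    (hη.hasCompactSupport.comp_smul (inv_ne_zero hr.ne')).mul_left
  have : mollify μ η r f = (f ⋆[ContinuousLinearMap.lsmul ℝ ℝ, μ] k) := by
    ext x
    rw [mollify_eq_integral_kernel η hr, convolution_def]
    refine integral_congr_ae (Eventually.of_forall fun y => ?_)
    simp [k]
    ring
  rw [this]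
  exact hkc.contDiff_convolution_right _ hf (by exact_mod_cast hk)

end Mollify

/-! ### The Lipschitz representative of the force field. -/

instance isAddHaarMeasure_volume_prod {d : ℕ} :
    (volume : Measure (E d × E d)).IsAddHaarMeasure :=
  inferInstanceAs ((volume : Measure (E d)).prod (volume : Measure (E d))).IsAddHaarMeasure

theorem fderiv_comp_const_sub_apply {V : Type*} [NormedAddCommGroup V] [NormedSpace ℝ V]
    {k : V → ℝ} (hk : Differentiable ℝ k) (x t v : V) :
    fderiv ℝ (fun t => k (x - t)) t v = -fderiv ℝ k (x - t) v := by
  have h1 : HasFDerivAt k (fderiv ℝ k (x - t)) (x - t) := (hk _).hasFDerivAt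
  have h2 : HasFDerivAt (fun t => x - t) (-ContinuousLinearMap.id ℝ V) t :=
    (hasFDerivAt_id t).const_sub x
  have h3 : HasFDerivAt (fun t => k (x - t)) _ t := h1.comp t h2
  rw [h3.fderiv]
  simp

-- The mollifications of `F` have partial derivatives bounded by the sup norms of the weak ones, so
-- they share a Lipschitz constant. It passes to `F` on the full-measure set where they converge,
-- and a Lipschitz extension from that set is the representative.
open scoped Convolution in
theorem MemW1Infty.exists_lipschitz {d : ℕ} {F : E d → E d} (hF : MemW1Infty F) :
    ∃ (F' : E d → E d) (L : ℝ≥0), LipschitzWith L F' ∧ F =ᵐ[volume] F' := by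
  obtain ⟨hFm, hG⟩ := hF
  choose G hGm hGw using hG
  have hFl : LocallyIntegrable F volume := hFm.locallyIntegrable le_top
  set c : Fin d → ℝ := fun j => (eLpNorm (G j) ∞ volume).toReal
  have hGb : ∀ j, ∀ᵐ x, ‖G j x‖ ≤ c j := by
    intro j
    have hfin : eLpNormEssSup (G j) volume ≠ ⊤ := by simpa using (hGm j).2.ne
    filter_upwards [ae_le_eLpNormEssSup (f := G j) (μ := volume)] with x hx
    have := ENNReal.toReal_mono hfin hx
    simpa [c] using this
  set φ : ℕ → ContDiffBump (0 : E d) := fun n =>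
    ⟨1 / ((n : ℝ) + 1), 2 * (1 / ((n : ℝ) + 1)), by positivity,
      by have : 0 < 1 / ((n : ℝ) + 1) := by positivity
         linarith⟩
  set Fn : ℕ → E d → E d := fun n =>
    ((φ n).normed volume ⋆[ContinuousLinearMap.lsmul ℝ ℝ, volume] F)
  have hlim : ∀ᵐ x, Tendsto (fun n => Fn n x) atTop (𝓝 (F x)) := by
    refine ContDiffBump.ae_convolution_tendsto_right_of_locallyIntegrable (K := 2) ?_
      (Eventually.of_forall fun n => le_rfl) hFl
    simpa [φ] using (tendsto_one_div_add_atTop_nhds_zero_nat (𝕜 := ℝ)).const_mul 2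
  have hderiv : ∀ n x, HasFDerivAt (Fn n)
      ((F ⋆[(ContinuousLinearMap.lsmul ℝ ℝ).flip.precompR (E d), volume]
        fderiv ℝ ((φ n).normed volume)) x) x := by
    intro n x
    simp only [Fn, ← convolution_flip (L := ContinuousLinearMap.lsmul ℝ ℝ) (g := F)]
    exact (φ n).hasCompactSupport_normed.hasFDerivAt_convolution_right _ hFl
      ((φ n).contDiff_normed (n := 1)) x
  have hpart : ∀ n x j, ‖fderiv ℝ (Fn n) x (EuclideanSpace.single j 1)‖ ≤ c j := by
    intro n x j
    set k := (φ n).normed (volume : Measure (E d))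
    have hk : ContDiff ℝ ∞ k := (φ n).contDiff_normed
    -- Testing the weak derivative against the reflected kernel moves the derivative onto `G j`; the
    -- sign from the reflection cancels the one from integration by parts.
    have htest : IsTestFunction fun t => k (x - t) :=
      ⟨hk.comp (contDiff_const.sub contDiff_id),
        (φ n).hasCompactSupport_normed.comp_homeomorph (Homeomorph.subLeft x)⟩
    have hfd : ∀ t, fderiv ℝ (fun t => k (x - t)) t (EuclideanSpace.single j 1) =
        -fderiv ℝ k (x - t) (EuclideanSpace.single j 1) := fun t =>
      fderiv_comp_const_sub_apply (hk.differentiable (by simp)) x t _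
    have hval : fderiv ℝ (Fn n) x (EuclideanSpace.single j 1) = ∫ t, k (x - t) • G j t := by
      rw [(hderiv n x).fderiv, convolution_precompR_apply _ hFl
        ((φ n).hasCompactSupport_normed.fderiv ℝ) (hk.continuous_fderiv (by simp)),
        convolution_def]
      have := hGw j _ htest
      simp only [hfd, neg_smul, integral_neg, neg_inj] at this
      simpa using this
    rw [hval]
    have hki : Integrable (fun t => k (x - t)) volume := (φ n).integrable_normed.comp_sub_left x
    calc ‖∫ t, k (x - t) • G j t‖ ≤ ∫ t, k (x - t) * c j := by
          refine norm_integral_le_of_norm_le (hki.mul_const _) ?_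
          filter_upwards [hGb j] with t ht
          rw [norm_smul, Real.norm_of_nonneg ((φ n).nonneg_normed _)]
          exact mul_le_mul_of_nonneg_left ht ((φ n).nonneg_normed _)
      _ = c j := by
          rw [integral_mul_const, integral_sub_left_eq_self k volume x, (φ n).integral_normed,
            one_mul]
  have hLip : ∀ n, LipschitzWith (Real.toNNReal (∑ j, c j)) (Fn n) := by
    intro n
    refine lipschitzWith_of_nnnorm_fderiv_le (fun x => (hderiv n x).differentiableAt) fun x => ?_
    rw [← NNReal.coe_le_coe, coe_nnnorm]
    refine le_trans ?_ (Real.le_coe_toNNReal _)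
    refine ContinuousLinearMap.opNorm_le_bound _
      (Finset.sum_nonneg fun j _ => ENNReal.toReal_nonneg) fun v => ?_
    have hv : v = ∑ j, v j • EuclideanSpace.single j (1 : ℝ) := by
      conv_lhs => rw [← (EuclideanSpace.basisFun (Fin d) ℝ).sum_repr v]
      simp
    calc ‖fderiv ℝ (Fn n) x v‖
        = ‖∑ j, v j • fderiv ℝ (Fn n) x (EuclideanSpace.single j (1 : ℝ))‖ := by
          conv_lhs => rw [hv]
          simp only [map_sum, map_smul]
      _ ≤ ∑ j, ‖v j • fderiv ℝ (Fn n) x (EuclideanSpace.single j (1 : ℝ))‖ := norm_sum_le _ _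
      _ ≤ ∑ j, c j * ‖v‖ := by
          refine Finset.sum_le_sum fun j _ => ?_
          rw [norm_smul, mul_comm]
          exact mul_le_mul (hpart n x j) (PiLp.norm_apply_le v j) (norm_nonneg _)
            ENNReal.toReal_nonneg
      _ = (∑ j, c j) * ‖v‖ := by rw [Finset.sum_mul]
  have hLipOn : LipschitzOnWith (Real.toNNReal (∑ j, c j)) F
      {x | Tendsto (fun n => Fn n x) atTop (𝓝 (F x))} := by
    refine LipschitzOnWith.of_dist_le_mul fun x hx y hy => ?_
    exact le_of_tendsto (Tendsto.dist hx hy)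
      (Eventually.of_forall fun n => (hLip n).dist_le_mul x y)
  obtain ⟨F', hF', heq⟩ := hLipOn.extend_finite_dimension
  exact ⟨F', _, hF', hlim.mono fun x hx => heq hx⟩

theorem HasWeakTransport.congr_force {d : ℕ} {F F' : E d → E d} {f g : E d × E d → ℝ}
    (h : HasWeakTransport F f g) (hF : F =ᵐ[volume] F') : HasWeakTransport F' f g := by
  intro φ hφ
  rw [← h φ hφ]
  have : ∀ᵐ z : E d × E d, F z.1 = F' z.1 := Measure.quasiMeasurePreserving_fst.ae hF
  refine integral_congr_ae ?_
  filter_upwards [this] with z hz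
  rw [hz]

/-! ### The transport term of a mollified solution. -/

theorem lipschitzWith_transportField {d : ℕ} {F : E d → E d} {L : ℝ≥0} (hF : LipschitzWith L F) :
    LipschitzWith (max 1 L) fun z : E d × E d => (z.2, F z.1) := by
  have := (LipschitzWith.prod_snd (α := E d) (β := E d)).prodMk (hF.comp LipschitzWith.prod_fst)
  simpa using this

-- With `b = (v, F)` and `k` the rescaled kernel, the weak equation turns the transport term at `z`
-- into the integral of `f y * Dk(z - y)(b z - b y) + g y * k(z - y)`. Differentiating `k` costs
-- `δ⁻¹`, but `b z - b y` is of order `δ` on its support, so everything is dominated by a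
-- convolution with a kernel of mass independent of `δ`. Only boundedness of the commutator is
-- needed, not its convergence to zero.
open scoped Convolution in
theorem exists_bound_integral_transport_mollify {d : ℕ} {F : E d → E d} {L : ℝ≥0}
    (hF : LipschitzWith L F) {η : E d × E d → ℝ} (hη : IsMollifier volume η) :
    ∃ C R₀ : ℝ, 0 ≤ C ∧ ∀ f g : E d × E d → ℝ, LocallyIntegrable f volume →
      LocallyIntegrable g volume → HasWeakTransport F f g → ∀ δ, 0 < δ → δ ≤ 1 → ∀ R : ℝ,
      ∫ z in closedBall 0 R, |fderiv ℝ (mollify volume η δ f) z (z.2, F z.1)| ≤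
        C * ((∫ z in closedBall 0 (R + R₀), |f z|) + ∫ z in closedBall 0 (R + R₀), |g z|) := by
  obtain ⟨R₀, hR₀, hsupp⟩ := exists_radius_of_hasCompactSupport hη.hasCompactSupport
  obtain ⟨S, hS⟩ := hη.hasCompactSupport.exists_bound_of_continuous hη.contDiff.continuous
  obtain ⟨S', hS'⟩ := (hη.hasCompactSupport.fderiv ℝ).exists_bound_of_continuous
    (hη.contDiff.continuous_fderiv (by simp))
  have hS0 : 0 ≤ S := (norm_nonneg _).trans (hS 0)
  have hS0' : 0 ≤ S' := (norm_nonneg _).trans (hS' 0)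
  set b : E d × E d → E d × E d := fun z => (z.2, F z.1)
  have hb : LipschitzWith (max 1 L) b := lipschitzWith_transportField hF
  set n := Module.finrank ℝ (E d × E d)
  -- `S` serves the `g` term; the other summand serves the commutator, once `δ⁻¹` has cancelled
  -- against the increment `R₀ * δ`.
  set A : ℝ := S + S' * (((max 1 L : ℝ≥0) : ℝ) * R₀)
  have hA : 0 ≤ A := by positivity
  refine ⟨A * (R₀ ^ n * volume.real (ball (0 : E d × E d) 1)), R₀, by positivity, ?_⟩
  intro f g hf hg hfg δ hδ hδ1 R
  set c : ℝ := (δ ^ n)⁻¹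
  have hc : 0 ≤ c := by positivity
  set k : E d × E d → ℝ := fun w => c * η (δ⁻¹ • w)
  have hk : ContDiff ℝ ∞ k := contDiff_const.mul (hη.contDiff.comp (contDiff_const_smul _))
  have hkc : HasCompactSupport k :=
    (hη.hasCompactSupport.comp_smul (inv_ne_zero hδ.ne')).mul_left
  have hfd : ∀ w, fderiv ℝ k w = (c * δ⁻¹) • fderiv ℝ η (δ⁻¹ • w) := by
    intro w
    have h1 : HasFDerivAt η (fderiv ℝ η (δ⁻¹ • w)) (δ⁻¹ • w) :=
      (hη.contDiff.differentiable (by simp) _).hasFDerivAt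
    have h2 : HasFDerivAt (fun w : E d × E d => δ⁻¹ • w)
      (δ⁻¹ • ContinuousLinearMap.id ℝ (E d × E d)) w := (hasFDerivAt_id w).const_smul δ⁻¹
    have h3 : HasFDerivAt k _ w := (h1.comp w h2).const_mul c
    rw [h3.fderiv]
    ext <;> simp [mul_assoc]
  have hscale : ∀ w : E d × E d, R₀ * δ < ‖w‖ → R₀ < ‖δ⁻¹ • w‖ := by
    intro w hw
    rwa [norm_smul, norm_inv, Real.norm_of_nonneg hδ.le, lt_inv_mul_iff₀ hδ, mul_comm]
  have hk0 : ∀ w, R₀ * δ < ‖w‖ → k w = 0 := fun w hw => by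
    simp [k, hsupp _ (hscale w hw)]
  have hk0' : ∀ w, R₀ * δ < ‖w‖ → fderiv ℝ k w = 0 := fun w hw => by
    have hev : k =ᶠ[𝓝 w] fun _ => 0 := by
      filter_upwards [(isOpen_lt continuous_const continuous_norm).mem_nhds hw] with w' hw'
      exact hk0 w' hw'
    rw [hev.fderiv_eq]
    simp
  -- A flat majorant of both kernels; the volume of the ball cancels the factor `δ ^ n` in `c`.
  set J : E d × E d → ℝ := (closedBall 0 (R₀ * δ)).indicator fun _ => c * A
  have hJ : Integrable J volume :=
    (integrable_indicator_iff measurableSet_closedBall).2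
      (integrableOn_const (isCompact_closedBall _ _).measure_lt_top.ne)
  have hJint : ∫ w, J w = A * (R₀ ^ n * volume.real (ball (0 : E d × E d) 1)) := by
    rw [integral_indicator measurableSet_closedBall, setIntegral_const, smul_eq_mul,
      Measure.addHaar_real_closedBall _ _ (by positivity), mul_pow]
    have : δ ^ n ≠ 0 := by positivity
    simp only [c, n] at this ⊢
    field_simp
  set H : E d × E d → ℝ := (closedBall 0 (R + R₀)).indicator fun y => |f y| + |g y|
  have hfB := hf.integrableOn_isCompact (isCompact_closedBall (0 : E d × E d) (R + R₀))
  have hgB := hg.integrableOn_isCompact (isCompact_closedBall (0 : E d × E d) (R + R₀))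
  have hH : Integrable H volume :=
    (integrable_indicator_iff measurableSet_closedBall).2 (hfB.abs.add hgB.abs)
  have hHint : ∫ y, H y = (∫ z in closedBall 0 (R + R₀), |f z|) +
      ∫ z in closedBall 0 (R + R₀), |g z| := by
    rw [integral_indicator measurableSet_closedBall, integral_add hfB.abs hgB.abs]
  have hconv : mollify volume η δ f = (f ⋆[ContinuousLinearMap.lsmul ℝ ℝ, volume] k) := by
    ext x
    rw [mollify_eq_integral_kernel η hδ, convolution_def]
    refine integral_congr_ae (Eventually.of_forall fun y => ?_)
    simp only [k, c, n, ContinuousLinearMap.lsmul_apply, smul_eq_mul]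
    ring
  have hmulint : ∀ (f : E d × E d → ℝ), LocallyIntegrable f volume → ∀ q : E d × E d → ℝ,
      Continuous q → HasCompactSupport q → Integrable (fun y => f y * q y) volume := by
    intro f hf q hq hqc
    have := hf.integrable_smul_right_of_hasCompactSupport hq hqc
    simpa using this
  have hpt : ∀ z, fderiv ℝ (mollify volume η δ f) z (b z) =
      ∫ y, (f y * fderiv ℝ k (z - y) (b z - b y) + g y * k (z - y)) := by
    intro z
    have htest : IsTestFunction fun t => k (z - t) :=
      ⟨hk.comp (contDiff_const.sub contDiff_id), hkc.comp_homeomorph (Homeomorph.subLeft z)⟩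
    have hfdk : ∀ t v, fderiv ℝ (fun t => k (z - t)) t v = -fderiv ℝ k (z - t) v :=
      fderiv_comp_const_sub_apply (hk.differentiable (by simp)) z
    have hweak := hfg _ htest
    simp only [hfdk, mul_neg, integral_neg, neg_inj] at hweak
    have hDk : Continuous fun y => fderiv ℝ k (z - y) :=
      (hk.continuous_fderiv (by simp)).comp (continuous_const.sub continuous_id)
    have hDkc : HasCompactSupport fun y => fderiv ℝ k (z - y) :=
      (hkc.fderiv ℝ).comp_homeomorph (Homeomorph.subLeft z)
    have hi1 : ∀ v : E d × E d → E d × E d, Continuous v →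
        Integrable (fun y => f y * fderiv ℝ k (z - y) (v y)) volume := fun v hv =>
      hmulint f hf _ (hDk.clm_apply hv) (hDkc.mono' fun y hy => subset_tsupport _ (by
        intro h0
        exact hy (by simp only [h0, _root_.zero_apply])))
    have hi2 : Integrable (fun y => g y * k (z - y)) volume :=
      hmulint g hg _ htest.1.continuous htest.2
    have hd : fderiv ℝ (mollify volume η δ f) z (b z) =
        ∫ y, f y * fderiv ℝ k (z - y) (b z) := by
      rw [hconv, (hkc.hasFDerivAt_convolution_right _ hf (hk.of_le (by simp)) z).fderiv,
        convolution_precompR_apply _ hf (hkc.fderiv ℝ) (hk.continuous_fderiv (by simp)),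
        convolution_def]
      simp
    have hsplit : ∀ y, f y * fderiv ℝ k (z - y) (b z - b y) =
        f y * fderiv ℝ k (z - y) (b z) - f y * fderiv ℝ k (z - y) (b y) := by
      intro y
      rw [map_sub, mul_sub]
    rw [integral_add (hi1 (fun y => b z - b y) (continuous_const.sub hb.continuous)) hi2]
    simp only [hsplit]
    rw [integral_sub (hi1 _ continuous_const) (hi1 _ hb.continuous), hd, ← hweak]
    simp [b]
  have hbound : ∀ z ∈ closedBall (0 : E d × E d) R,
      |fderiv ℝ (mollify volume η δ f) z (b z)| ≤
        (H ⋆[ContinuousLinearMap.lsmul ℝ ℝ, volume] J) z := by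
    intro z hz
    rw [mem_closedBall_zero_iff] at hz
    rw [hpt z, convolution_def, ← Real.norm_eq_abs]
    have hJm : Measurable fun y => J (z - y) :=
      (measurable_const.indicator measurableSet_closedBall).comp (by fun_prop)
    refine norm_integral_le_of_norm_le ?_ (Eventually.of_forall fun y => ?_)
    · simp only [ContinuousLinearMap.lsmul_apply, smul_eq_mul]
      refine hH.mul_bdd (c := c * A) hJm.aestronglyMeasurable (Eventually.of_forall fun y => ?_)
      simp only [J]
      rw [Real.norm_of_nonneg (indicator_nonneg (fun _ _ => by positivity) _)]
      exact indicator_le_self' (fun _ _ => by positivity) _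
    · simp only [ContinuousLinearMap.lsmul_apply, smul_eq_mul]
      by_cases hzy : R₀ * δ < ‖z - y‖
      · rw [hk0 _ hzy, hk0' _ hzy]
        simp only [_root_.zero_apply, mul_zero, add_zero, norm_zero]
        exact mul_nonneg (indicator_nonneg (fun _ _ => by positivity) _)
          (indicator_nonneg (fun _ _ => by positivity) _)
      · rw [not_lt] at hzy
        have hRδ : R₀ * δ ≤ R₀ := mul_le_of_le_one_right hR₀.le hδ1
        have hy : y ∈ closedBall (0 : E d × E d) (R + R₀) := by
          rw [mem_closedBall_zero_iff]
          have : ‖y‖ ≤ ‖z‖ + ‖z - y‖ := by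
            calc ‖y‖ = ‖z - (z - y)‖ := by rw [sub_sub_cancel]
              _ ≤ _ := norm_sub_le _ _
          linarith
        have hzy' : z - y ∈ closedBall (0 : E d × E d) (R₀ * δ) := by
          rwa [mem_closedBall_zero_iff]
        simp only [H, J, indicator_of_mem hy, indicator_of_mem hzy']
        have e1 : |k (z - y)| ≤ c * S := by
          simp only [k, abs_mul, abs_of_nonneg hc]
          exact mul_le_mul_of_nonneg_left (hS _) hc
        have e2 : |fderiv ℝ k (z - y) (b z - b y)| ≤
            c * (S' * (((max 1 L : ℝ≥0) : ℝ) * R₀)) := by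
          have hbl : ‖b z - b y‖ ≤ ((max 1 L : ℝ≥0) : ℝ) * (R₀ * δ) := by
            have := hb.dist_le_mul z y
            rw [dist_eq_norm, dist_eq_norm] at this
            exact this.trans (mul_le_mul_of_nonneg_left hzy (NNReal.coe_nonneg _))
          have hkn : ‖fderiv ℝ k (z - y)‖ ≤ c * δ⁻¹ * S' := by
            rw [hfd, norm_smul, Real.norm_of_nonneg (by positivity)]
            exact mul_le_mul_of_nonneg_left (hS' _) (by positivity)
          calc |fderiv ℝ k (z - y) (b z - b y)| ≤ ‖fderiv ℝ k (z - y)‖ * ‖b z - b y‖ :=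
                (fderiv ℝ k (z - y)).le_opNorm _
            _ ≤ (c * δ⁻¹ * S') * (((max 1 L : ℝ≥0) : ℝ) * (R₀ * δ)) :=
                mul_le_mul hkn hbl (norm_nonneg _) (by positivity)
            _ = _ := by
                field_simp
        calc ‖f y * fderiv ℝ k (z - y) (b z - b y) + g y * k (z - y)‖
            ≤ |f y| * |fderiv ℝ k (z - y) (b z - b y)| + |g y| * |k (z - y)| := by
              rw [← abs_mul, ← abs_mul]
              exact abs_add_le _ _
          _ ≤ |f y| * (c * (S' * (((max 1 L : ℝ≥0) : ℝ) * R₀))) + |g y| * (c * S) := by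
              gcongr
          _ ≤ (|f y| + |g y|) * (c * A) := by
              have i1 : 0 ≤ |f y| * (c * S) := by positivity
              have i2 : 0 ≤ |g y| * (c * (S' * (((max 1 L : ℝ≥0) : ℝ) * R₀))) := by positivity
              simp only [A]
              nlinarith
  have hHJ : Integrable (H ⋆[ContinuousLinearMap.lsmul ℝ ℝ, volume] J) volume :=
    hH.integrable_convolution _ hJ
  have hHJ0 : ∀ z, 0 ≤ (H ⋆[ContinuousLinearMap.lsmul ℝ ℝ, volume] J) z := by
    intro z
    rw [convolution_def]
    refine integral_nonneg fun y => ?_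
    simp only [ContinuousLinearMap.lsmul_apply, smul_eq_mul]
    exact mul_nonneg (indicator_nonneg (fun _ _ => by positivity) _)
      (indicator_nonneg (fun _ _ => by positivity) _)
  calc ∫ z in closedBall 0 R, |fderiv ℝ (mollify volume η δ f) z (b z)|
      ≤ ∫ z in closedBall 0 R, (H ⋆[ContinuousLinearMap.lsmul ℝ ℝ, volume] J) z := by
        refine setIntegral_mono_on ?_ hHJ.integrableOn measurableSet_closedBall hbound
        have hcd := hη.contDiff_mollify hδ hf
        exact (((hcd.continuous_fderiv (by simp)).clm_apply hb.continuous).abs).continuousOn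
          |>.integrableOn_compact (isCompact_closedBall _ _)
    _ ≤ ∫ z, (H ⋆[ContinuousLinearMap.lsmul ℝ ℝ, volume] J) z :=
        setIntegral_le_integral hHJ (Eventually.of_forall hHJ0)
    _ = (∫ y, H y) * ∫ w, J w := by
        rw [integral_convolution _ hH hJ]
        simp
    _ = _ := by rw [hHint, hJint, mul_comm]

/-- Convergence holds at Lebesgue points, because the kernel is at most a constant over the volume
of the ball of radius `R * δ n` that contains its support. -/
theorem IsMollifier.ae_tendsto_mollify {V : Type*} [NormedAddCommGroup V] [NormedSpace ℝ V]
    [FiniteDimensional ℝ V] [MeasurableSpace V] [BorelSpace V] {μ : Measure V} [μ.IsAddHaarMeasure]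
    {η : V → ℝ} (hη : IsMollifier μ η) {f : V → ℝ} (hf : LocallyIntegrable f μ) {δ : ℕ → ℝ}
    (hδ : ∀ n, 0 < δ n) (hδ0 : Tendsto δ atTop (𝓝 0)) :
    ∀ᵐ x ∂μ, Tendsto (fun n => mollify μ η (δ n) f x) atTop (𝓝 (f x)) := by
  obtain ⟨R, hR, hsupp⟩ := exists_radius_of_hasCompactSupport hη.hasCompactSupport
  obtain ⟨S, hS⟩ := hη.hasCompactSupport.exists_bound_of_continuous hη.contDiff.continuous
  filter_upwards [(Besicovitch.vitaliFamily μ).ae_tendsto_average_norm_sub hf] with x hx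
  have hr : Tendsto (fun n => R * δ n) atTop (𝓝[>] 0) :=
    tendsto_nhdsWithin_iff.2 ⟨by simpa using hδ0.const_mul R,
      Eventually.of_forall fun n => mul_pos hR (hδ n)⟩
  have key := (hx.comp (Besicovitch.tendsto_filterAt μ x)).comp hr
  simp only [mollify_eq_integral_kernel η (hδ _)]
  refine tendsto_integral_smul_of_tendsto_average_norm_sub
    (S * (R ^ Module.finrank ℝ V * μ.real (ball 0 1))) key ?_ ?_ ?_ ?_
  · exact Eventually.of_forall fun n => hf.integrableOn_isCompact (isCompact_closedBall _ _)
  · refine tendsto_const_nhds.congr fun n => ?_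
    have := mollify_eq_integral_kernel (μ := μ) η (hδ n) (fun _ => 1) x
    simp only [mollify, mul_one, hη.integral_eq_one] at this
    exact this
  · refine Eventually.of_forall fun n y hy => ?_
    simp only [mem_closedBall]
    by_contra hlt
    rw [not_le, dist_eq_norm, norm_sub_rev] at hlt
    refine hy ?_
    simp only
    rw [hsupp, mul_zero]
    rwa [norm_smul, norm_inv, Real.norm_of_nonneg (hδ n).le, lt_inv_mul_iff₀ (hδ n), mul_comm]
  · refine Eventually.of_forall fun n y => ?_
    have hd := hδ n
    simp only
    rw [Measure.addHaar_real_closedBall _ _ (by positivity), abs_mul,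
      abs_of_nonneg (by positivity), mul_pow]
    have hpos : 0 < μ.real (ball (0 : V) 1) := 
      ENNReal.toReal_pos (measure_ball_pos μ 0 one_pos).ne' measure_ball_lt_top.ne
    have hp : 0 < δ n ^ Module.finrank ℝ V := by positivity
    have hq : 0 < R ^ Module.finrank ℝ V := by positivity
    rw [show S * (R ^ Module.finrank ℝ V * μ.real (ball 0 1)) /
      (R ^ Module.finrank ℝ V * δ n ^ Module.finrank ℝ V * μ.real (ball 0 1)) =
      (δ n ^ Module.finrank ℝ V)⁻¹ * S by field_simp]
    exact mul_le_mul_of_nonneg_left (hS _) (by positivity)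

/-! ### Truncation and equiintegrability. -/

/-- A smooth bounded truncation of the identity of `ℝ`. -/
def truncation (M a : ℝ) : ℝ := a * M ^ 2 / (M ^ 2 + a ^ 2)

theorem contDiff_truncation {M : ℝ} (hM : 0 < M) : ContDiff ℝ ∞ (truncation M) := by
  unfold truncation
  exact (contDiff_id.mul contDiff_const).div (contDiff_const.add (contDiff_id.pow 2))
    fun a => by positivity

theorem abs_truncation_le {M : ℝ} (hM : 0 < M) (a : ℝ) : |truncation M a| ≤ M := by
  rw [truncation, abs_div, abs_of_pos (show 0 < M ^ 2 + a ^ 2 by positivity),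
    div_le_iff₀ (by positivity), abs_mul, abs_of_nonneg (sq_nonneg M), ← sq_abs a]
  nlinarith [sq_nonneg (M - |a|), abs_nonneg a, mul_nonneg hM.le (abs_nonneg a)]

theorem hasDerivAt_truncation {M : ℝ} (hM : 0 < M) (a : ℝ) :
    HasDerivAt (truncation M) (M ^ 2 * (M ^ 2 - a ^ 2) / (M ^ 2 + a ^ 2) ^ 2) a := by
  have hp : M ^ 2 + a ^ 2 ≠ 0 := by positivity
  have h1 : HasDerivAt (fun y : ℝ => y * M ^ 2) (M ^ 2) a := by
    simpa using (hasDerivAt_id a).mul_const (M ^ 2)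
  have h2 : HasDerivAt (fun y : ℝ => M ^ 2 + y ^ 2) (2 * a) a := by
    simpa using (hasDerivAt_pow 2 a).const_add (M ^ 2)
  have h3 : HasDerivAt (truncation M) _ a := h1.div h2 hp
  refine h3.congr_deriv ?_
  ring

theorem abs_deriv_truncation_le {M : ℝ} (hM : 0 < M) (a : ℝ) : |deriv (truncation M) a| ≤ 1 := by
  have hp : 0 < M ^ 2 + a ^ 2 := by positivity
  rw [(hasDerivAt_truncation hM a).deriv, abs_div, abs_of_pos (pow_pos hp 2),
    div_le_one (pow_pos hp 2), abs_le]
  constructor <;> nlinarith [sq_nonneg a, sq_nonneg M, mul_nonneg (sq_nonneg a) (sq_nonneg M),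
    mul_nonneg (sq_nonneg M) (sq_nonneg M), mul_nonneg (sq_nonneg a) (sq_nonneg a)]

theorem abs_sub_truncation_eq {M : ℝ} (hM : 0 < M) (a : ℝ) :
    |a - truncation M a| = |a| * (a ^ 2 / (M ^ 2 + a ^ 2)) := by
  have hp : 0 < M ^ 2 + a ^ 2 := by positivity
  rw [show a - truncation M a = a * (a ^ 2 / (M ^ 2 + a ^ 2)) by
    rw [truncation]
    field_simp
    ring, abs_mul, abs_of_nonneg (a := a ^ 2 / _) (by positivity)]

theorem abs_sub_truncation_le_abs {M : ℝ} (hM : 0 < M) (a : ℝ) :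
    |a - truncation M a| ≤ |a| := by
  rw [abs_sub_truncation_eq hM]
  refine mul_le_of_le_one_right (abs_nonneg a) ?_
  rw [div_le_one (by positivity)]
  nlinarith [sq_nonneg M]

theorem abs_sub_truncation_sq_le {m : ℝ} (hm : 0 < m) {a : ℝ} (ha : |a| ≤ m) :
    |a - truncation (m ^ 2) a| ≤ 1 / m := by
  rw [abs_sub_truncation_eq (by positivity)]
  have h2 : a ^ 2 ≤ m ^ 2 := by
    rw [← sq_abs a]
    gcongr
  calc |a| * (a ^ 2 / ((m ^ 2) ^ 2 + a ^ 2)) ≤ m * (m ^ 2 / ((m ^ 2) ^ 2)) := by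
        gcongr
        nlinarith [sq_nonneg a]
    _ = 1 / m := by
        field_simp

/-- By Chebyshev's inequality the set where `|f i| ≥ m` has measure below the threshold of
equiintegrability, and there the truncation error is at most `|f i|`. Elsewhere truncating at level
`m ^ 2`, far above `m`, costs at most `1 / m`. -/
theorem LocallyEquiintegrable.exists_truncation {d : ℕ} {ι : Type*} {f : ι → E d × E d → ℝ}
    (hf : LocallyEquiintegrable f) {K : Set (E d × E d)} (hK : IsCompact K) {ε : ℝ} (hε : 0 < ε) :
    ∃ M, 0 < M ∧ ∀ i, ∫ z in K, |f i z - truncation M (f i z)| ≤ ε := by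
  obtain ⟨α, hα, hequi⟩ := hf.2 (ε / 2) (half_pos hε) K hK
  obtain ⟨C, hC⟩ := hf.1.2 K hK
  set T : ℝ := volume.real K
  -- The three lower bounds give positivity of `m`, measure below `α` in Chebyshev's inequality, and
  -- `T / m ≤ ε / 2`.
  obtain ⟨m, hm⟩ := exists_gt (max 1 (max (|C| / α) (2 * T / ε)))
  simp only [max_lt_iff] at hm
  obtain ⟨hm1, hmα, hmT⟩ := hm
  have hm0 : 0 < m := one_pos.trans hm1
  refine ⟨m ^ 2, by positivity, fun i => ?_⟩
  have hfi : IntegrableOn (f i) K volume := (hf.1.1 i).integrableOn_isCompact hK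
  have hms := (hf.1.1 i).aestronglyMeasurable
  -- Equiintegrability speaks of measurable sets, so the superlevel set is taken for a measurable
  -- representative.
  set f' := hms.mk (f i)
  have hf'm : Measurable f' := hms.stronglyMeasurable_mk.measurable
  have hff' : f i =ᵐ[volume] f' := hms.ae_eq_mk
  set A : Set (E d × E d) := K ∩ {z | m ≤ |f' z|}
  have hA : MeasurableSet A := hK.measurableSet.inter (measurableSet_le measurable_const hf'm.abs)
  have hf'i : IntegrableOn f' K volume := hfi.congr (ae_restrict_of_ae hff')
  have hAreal : volume.real A < α := by
    have h1 := mul_meas_ge_le_integral_of_nonneg (μ := volume.restrict K) (f := fun z => |f' z|)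
      (Eventually.of_forall fun z => abs_nonneg _) hf'i.abs m
    have h2 : ∫ z in K, |f' z| = ∫ z in K, |f i z| :=
      integral_congr_ae ((ae_restrict_of_ae hff').mono fun z hz => by simp only [hz])
    have h3 : (volume.restrict K).real {z | m ≤ |f' z|} = volume.real A := by
      rw [measureReal_restrict_apply (measurableSet_le measurable_const hf'm.abs), inter_comm]
    rw [h2, h3] at h1
    have h4 : m * volume.real A ≤ |C| := h1.trans ((hC i).trans (le_abs_self C))
    rw [div_lt_iff₀ hα] at hmα
    by_contra hcon
    rw [not_lt] at hcon
    nlinarith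
  have hAfin : volume A ≠ ⊤ := ((measure_mono inter_subset_left).trans_lt hK.measure_lt_top).ne
  have hAvol : volume A < ENNReal.ofReal α := by
    rw [← ENNReal.ofReal_toReal hAfin]
    exact (ENNReal.ofReal_lt_ofReal_iff hα).2 hAreal
  have hA' := hequi A hA hAvol i
  have hswap : ∫ z in A, K.indicator (fun z => |f i z|) z =
      ∫ z in K, A.indicator (fun z => |f i z|) z := by
    rw [setIntegral_indicator hK.measurableSet, setIntegral_indicator hA, inter_comm]
  have hind : IntegrableOn (A.indicator fun z => |f i z|) K volume := hfi.abs.indicator hA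
  have hconst : IntegrableOn (fun _ : E d × E d => 1 / m) K volume :=
    integrableOn_const hK.measure_lt_top.ne
  calc ∫ z in K, |f i z - truncation (m ^ 2) (f i z)|
      ≤ ∫ z in K, (1 / m + A.indicator (fun z => |f i z|) z) := by
        refine integral_mono_of_nonneg (Eventually.of_forall fun z => abs_nonneg _)
          (hconst.add hind) ?_
        filter_upwards [ae_restrict_of_ae hff', ae_restrict_mem hK.measurableSet] with z hz hzK
        by_cases hzm : m ≤ |f' z|
        · have hzA : z ∈ A := ⟨hzK, hzm⟩
          rw [indicator_of_mem hzA]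
          have := abs_sub_truncation_le_abs (show 0 < m ^ 2 by positivity) (f i z)
          have : 0 ≤ 1 / m := by positivity
          linarith
        · have hzA : z ∉ A := fun h => hzm h.2
          rw [indicator_of_notMem hzA, add_zero]
          refine abs_sub_truncation_sq_le hm0 ?_
          rw [hz]
          exact (not_le.1 hzm).le
    _ = T * (1 / m) + ∫ z in A, K.indicator (fun z => |f i z|) z := by
        rw [integral_add hconst hind, setIntegral_const, smul_eq_mul, hswap]
    _ ≤ ε / 2 + ε / 2 := by
        gcongr
        rw [div_lt_iff₀ hε] at hmT
        rw [mul_one_div, div_le_iff₀ hm0]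
        linarith
    _ = ε := add_halves ε

/-- The function `u` is the truncation of a mollification of `f i`. The chain rule with slope at
most one preserves the transport bound, which is uniform in the radius. The radius may therefore
depend on `i`, and no uniform rate of mollification is needed. -/
theorem exists_bounded_approximation {d : ℕ} {ι : Type*} {F : E d → E d} {L : ℝ≥0}
    (hF : LipschitzWith L F) {f g : ι → E d × E d → ℝ} (hf : LocallyEquiintegrable f)
    (hfg : ∀ i, HasWeakTransport F (f i) (g i)) (hg : BoundedInL1loc g) (R : ℝ) {ε : ℝ}
    (hε : 0 < ε) :
    ∃ M G : ℝ, 0 ≤ M ∧ 0 ≤ G ∧ ∀ i, ∃ u : E d × E d → ℝ, ContDiff ℝ 1 u ∧ (∀ z, |u z| ≤ M) ∧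
      ∫ z in closedBall 0 R, |fderiv ℝ u z (z.2, F z.1)| ≤ G ∧
      ∫ z in closedBall 0 R, |f i z - u z| ≤ ε := by
  obtain ⟨η, hη⟩ := exists_isMollifier (volume : Measure (E d × E d))
  obtain ⟨C, R₀, hC, hbound⟩ := exists_bound_integral_transport_mollify hF hη
  obtain ⟨Cf, hCf⟩ := hf.1.2 _ (isCompact_closedBall (0 : E d × E d) (R + R₀))
  obtain ⟨Cg, hCg⟩ := hg.2 _ (isCompact_closedBall (0 : E d × E d) (R + R₀))
  have hK : IsCompact (closedBall (0 : E d × E d) R) := isCompact_closedBall _ _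
  obtain ⟨M, hM, htrunc⟩ := hf.exists_truncation hK (half_pos hε)
  refine ⟨M, C * (|Cf| + |Cg|), hM.le, by positivity, fun i => ?_⟩
  set δ : ℕ → ℝ := fun n => 1 / ((n : ℝ) + 1)
  have hδ : ∀ n, 0 < δ n := fun n => by positivity
  have hδ1 : ∀ n, δ n ≤ 1 := fun n => by
    simp only [δ]
    rw [div_le_one (by positivity)]
    linarith [(Nat.cast_nonneg n : (0 : ℝ) ≤ n)]
  set w : ℕ → E d × E d → ℝ := fun n => mollify volume η (δ n) (f i)
  have hw : ∀ n, ContDiff ℝ ∞ (w n) := fun n => hη.contDiff_mollify (hδ n) (hf.1.1 i)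
  have hfin : IsFiniteMeasure (volume.restrict (closedBall (0 : E d × E d) R)) :=
    ⟨by simpa using hK.measure_lt_top⟩
  have htc := contDiff_truncation hM
  have hfm : AEStronglyMeasurable (f i) (volume.restrict (closedBall (0 : E d × E d) R)) :=
    (hf.1.1 i).aestronglyMeasurable.restrict
  have htfm : AEStronglyMeasurable (fun z => truncation M (f i z))
      (volume.restrict (closedBall (0 : E d × E d) R)) :=
    htc.continuous.comp_aestronglyMeasurable hfm
  have htwm : ∀ n, AEStronglyMeasurable (fun z => truncation M (w n z))
      (volume.restrict (closedBall (0 : E d × E d) R)) := fun n =>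
    (htc.continuous.comp (hw n).continuous).aestronglyMeasurable
  -- Truncation makes the integrands bounded, so a.e. convergence of the mollifications suffices.
  have hlim : Tendsto (fun n => ∫ z in closedBall 0 R,
      |truncation M (f i z) - truncation M (w n z)|) atTop (𝓝 0) := by
    have hzero : ∫ z in closedBall (0 : E d × E d) R, (0 : ℝ) = 0 := integral_zero _ _
    rw [← hzero]
    refine tendsto_integral_of_dominated_convergence (fun _ => 2 * M)
      (fun n => ((htfm.sub (htwm n)).norm)) (integrable_const _) (fun n => ?_) ?_
    · refine Eventually.of_forall fun z => ?_
      rw [Real.norm_eq_abs, abs_abs]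
      refine (abs_sub _ _).trans ?_
      linarith [abs_truncation_le hM (f i z), abs_truncation_le hM (w n z)]
    · filter_upwards [ae_restrict_of_ae (hη.ae_tendsto_mollify (hf.1.1 i) hδ
        tendsto_one_div_add_atTop_nhds_zero_nat)] with z hz
      have h1 := (htc.continuous.tendsto (f i z)).comp hz
      have h2 := (tendsto_const_nhds (x := truncation M (f i z))).sub h1
      rw [sub_self] at h2
      simpa using h2.abs
  obtain ⟨n, hn⟩ := ((tendsto_order.1 hlim).2 (ε / 2) (half_pos hε)).exists
  have hi1 : Integrable (fun z => f i z - truncation M (f i z))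
      (volume.restrict (closedBall (0 : E d × E d) R)) :=
    ((hf.1.1 i).integrableOn_isCompact hK).sub (Integrable.of_bound htfm M
      (Eventually.of_forall fun z => abs_truncation_le hM _))
  have hi2 : Integrable (fun z => truncation M (f i z) - truncation M (w n z))
      (volume.restrict (closedBall (0 : E d × E d) R)) :=
    (Integrable.of_bound htfm M (Eventually.of_forall fun z => abs_truncation_le hM _)).sub
      (Integrable.of_bound (htwm n) M (Eventually.of_forall fun z => abs_truncation_le hM _))
  refine ⟨fun z => truncation M (w n z), (htc.comp (hw n)).of_le (by simp),
    fun z => abs_truncation_le hM _, ?_, ?_⟩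
  · have hT : Continuous fun z : E d × E d => fderiv ℝ (w n) z (z.2, F z.1) :=
      ((hw n).continuous_fderiv (by simp)).clm_apply
        (lipschitzWith_transportField hF).continuous
    calc ∫ z in closedBall 0 R, |fderiv ℝ (fun z => truncation M (w n z)) z (z.2, F z.1)|
        ≤ ∫ z in closedBall 0 R, |fderiv ℝ (w n) z (z.2, F z.1)| := by
          refine integral_mono_of_nonneg (Eventually.of_forall fun z => abs_nonneg _)
            (hT.abs.continuousOn.integrableOn_compact hK) (Eventually.of_forall fun z => ?_)
          have h1 : HasDerivAt (truncation M) (deriv (truncation M) (w n z)) (w n z) :=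
            (htc.differentiable (by simp) _).hasDerivAt
          have h2 : HasFDerivAt (w n) (fderiv ℝ (w n) z) z :=
            ((hw n).differentiable (by simp) z).hasFDerivAt
          have h3 : HasFDerivAt (fun z => truncation M (w n z)) _ z := h1.comp_hasFDerivAt z h2
          simp only
          rw [h3.fderiv, _root_.smul_apply, smul_eq_mul, abs_mul]
          exact mul_le_of_le_one_left (abs_nonneg _) (abs_deriv_truncation_le hM _)
      _ ≤ C * ((∫ z in closedBall 0 (R + R₀), |f i z|) +
            ∫ z in closedBall 0 (R + R₀), |g i z|) :=
          hbound (f i) (g i) (hf.1.1 i) (hg.1 i) (hfg i) (δ n) (hδ n) (hδ1 n) R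
      _ ≤ C * (|Cf| + |Cg|) := by
          gcongr
          · exact (hCf i).trans (le_abs_self _)
          · exact (hCg i).trans (le_abs_self _)
  · calc ∫ z in closedBall 0 R, |f i z - truncation M (w n z)|
        ≤ ∫ z in closedBall 0 R, (|f i z - truncation M (f i z)| +
            |truncation M (f i z) - truncation M (w n z)|) := by
          refine integral_mono_of_nonneg (Eventually.of_forall fun z => abs_nonneg _)
            (hi1.abs.add hi2.abs) (Eventually.of_forall fun z => ?_)
          exact abs_sub_le _ _ _
      _ = _ := integral_add hi1.abs hi2.abs
      _ ≤ ε := by linarith [htrunc i]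

/-! ### Free transport and decorrelation of shifted profiles. -/

theorem integral_fderiv_apply_eq_zero {V : Type*} [NormedAddCommGroup V] [NormedSpace ℝ V]
    [FiniteDimensional ℝ V] [MeasurableSpace V] [BorelSpace V] {μ : Measure V} [μ.IsAddHaarMeasure]
    {p : V → ℝ} (hp : ContDiff ℝ 1 p) (hpc : HasCompactSupport p) (a : V) :
    ∫ x, fderiv ℝ p x a ∂μ = 0 := by
  have hi : Integrable (fun x => fderiv ℝ p x a) μ :=
    ((hp.continuous_fderiv one_ne_zero).clm_apply continuous_const).integrable_of_hasCompactSupport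
      (hpc.fderiv_apply ℝ a)
  have := integral_mul_fderiv_eq_neg_fderiv_mul_of_integrable (μ := μ) (f := fun _ => (1 : ℝ))
    (g := p) (v := a) (by simp) (by simpa using hi)
    (by simpa using hp.continuous.integrable_of_hasCompactSupport hpc)
    (fun x _ => differentiableAt_const _) (fun x _ => hp.differentiable one_ne_zero x)
  simpa using this

variable {d : ℕ}

theorem integrable_of_continuous_of_radius {q : E d × E d → ℝ} (hq : Continuous q) {R : ℝ}
    (hR : ∀ z, R < ‖z‖ → q z = 0) : Integrable q volume :=
  hq.integrable_of_hasCompactSupport (HasCompactSupport.intro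
    (isCompact_closedBall (0 : E d × E d) R) fun z hz => hR z (by simpa using hz))

/-- The part `(v, 0)` of the field does not depend on `x`, and `(0, F x)` does not depend on `v`; on
slices each is a constant directional derivative. Continuity of `F` is enough. -/
theorem integral_transport_eq_zero {F : E d → E d} (hF : Continuous F) {p : E d × E d → ℝ}
    (hp : ContDiff ℝ 1 p) (hpc : HasCompactSupport p) :
    ∫ z, fderiv ℝ p z (z.2, F z.1) = 0 := by
  obtain ⟨R, hR, hsupp⟩ := exists_radius_of_hasCompactSupport hpc
  have hcont := hp.continuous_fderiv one_ne_zero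
  have hint : ∀ b : E d × E d → E d × E d, Continuous b →
      Integrable (fun z => fderiv ℝ p z (b z)) volume := fun b hb =>
    (hcont.clm_apply hb).integrable_of_hasCompactSupport
      ((hpc.fderiv ℝ).mono' fun z hz => subset_tsupport _ fun h0 => hz (by simp [h0]))
  have h1 := hint (fun z => (z.2, 0)) (by fun_prop)
  have h2 := hint (fun z => (0, F z.1)) (by fun_prop)
  have hsplit : ∀ z : E d × E d, fderiv ℝ p z (z.2, F z.1) =
      fderiv ℝ p z (z.2, 0) + fderiv ℝ p z (0, F z.1) := fun z => by
    rw [← map_add]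
    simp
  simp only [hsplit]
  rw [integral_add h1 h2, Measure.volume_eq_prod, integral_prod_symm _ h1, integral_prod _ h2]
  have hx : ∀ v : E d, ∫ x : E d, fderiv ℝ p (x, v) (v, 0) = 0 := by
    intro v
    have hd : ∀ x, fderiv ℝ p (x, v) (v, 0) = fderiv ℝ (fun x => p (x, v)) x v := by
      intro x
      have h3 : HasFDerivAt (fun x => p (x, v)) _ x :=
        ((hp.differentiable one_ne_zero (x, v)).hasFDerivAt).comp x (hasFDerivAt_prodMk_left x v)
      rw [h3.fderiv]
      simp
    simp only [hd]
    refine integral_fderiv_apply_eq_zero (hp.comp (contDiff_prodMk_left v)) ?_ v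
    refine HasCompactSupport.intro (isCompact_closedBall (0 : E d) R) fun x hx => hsupp _ ?_
    rw [mem_closedBall_zero_iff, not_le] at hx
    exact hx.trans_le (norm_fst_le (x, v))
  have hv : ∀ x : E d, ∫ v : E d, fderiv ℝ p (x, v) (0, F x) = 0 := by
    intro x
    have hd : ∀ v, fderiv ℝ p (x, v) (0, F x) = fderiv ℝ (fun v => p (x, v)) v (F x) := by
      intro v
      have h3 : HasFDerivAt (fun v => p (x, v)) _ v :=
        ((hp.differentiable one_ne_zero (x, v)).hasFDerivAt).comp v (hasFDerivAt_prodMk_right x v)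
      rw [h3.fderiv]
      simp
    simp only [hd]
    refine integral_fderiv_apply_eq_zero (hp.comp (contDiff_prodMk_right x)) ?_ (F x)
    refine HasCompactSupport.intro (isCompact_closedBall (0 : E d) R) fun v hv => hsupp _ ?_
    rw [mem_closedBall_zero_iff, not_le] at hv
    exact hv.trans_le (norm_snd_le (x, v))
  simp [hx, hv]

/-- The derivative in `t` is the integral of `u θ v · ∇D(x + t v)`. Applying the transport operator
to `D(x + t v)` produces this plus `t F · ∇D`, so integration by parts leaves terms where the
operator falls on `u` or `θ`, and a force term. The factor `t` in the latter yields `s ^ 2 * ℓ`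
after integration in time. -/
theorem exists_bound_free_transport {F : E d → E d} (hF : Continuous F) {θ : E d × E d → ℝ}
    (hθ : ContDiff ℝ 1 θ) {R : ℝ} (hR : ∀ z, R < ‖z‖ → θ z = 0) :
    ∃ C : ℝ, 0 ≤ C ∧ ∀ (u : E d × E d → ℝ) (M G : ℝ), ContDiff ℝ 1 u → (∀ z, |u z| ≤ M) →
      ∫ z in closedBall 0 R, |fderiv ℝ u z (z.2, F z.1)| ≤ G → ∀ (D : E d → ℝ) (ℓ : ℝ),
      ContDiff ℝ 1 D → (∀ x, |D x| ≤ 2) → (∀ x, ‖fderiv ℝ D x‖ ≤ ℓ) → ∀ s, 0 ≤ s →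
      |(∫ z, u z * θ z * D (z.1 + s • z.2)) - ∫ z, u z * θ z * D z.1| ≤
        C * (M + G) * (s + s ^ 2 * ℓ) := by
  have hθc : HasCompactSupport θ := HasCompactSupport.intro
    (isCompact_closedBall (0 : E d × E d) R) fun z hz => hR z (by simpa using hz)
  obtain ⟨S, hS⟩ := hθc.exists_bound_of_continuous hθ.continuous
  have hS0 : 0 ≤ S := (norm_nonneg _).trans (hS 0)
  set b : E d × E d → E d × E d := fun z => (z.2, F z.1)
  have hb : Continuous b := by fun_prop
  have hTθ : Continuous fun z => fderiv ℝ θ z (b z) :=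
    (hθ.continuous_fderiv one_ne_zero).clm_apply hb
  have hTθ0 : ∀ z, R < ‖z‖ → fderiv ℝ θ z = 0 := by
    intro z hz
    have hev : θ =ᶠ[𝓝 z] fun _ => 0 := by
      filter_upwards [(isOpen_lt continuous_const continuous_norm).mem_nhds hz] with w hw
      exact hR w hw
    rw [hev.fderiv_eq]
    simp
  have hi1 : Integrable (fun z => |fderiv ℝ θ z (b z)|) volume :=
    integrable_of_continuous_of_radius (R := R) hTθ.abs fun z hz => by simp [hTθ0 z hz]
  have hi2 : Integrable (fun z : E d × E d => |θ z| * ‖F z.1‖) volume :=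
    integrable_of_continuous_of_radius (R := R) (hθ.continuous.abs.mul (by fun_prop))
      fun z hz => by simp [hR z hz]
  set I₁ : ℝ := ∫ z, |fderiv ℝ θ z (b z)|
  set I₂ : ℝ := ∫ z : E d × E d, |θ z| * ‖F z.1‖
  have hI₁ : 0 ≤ I₁ := integral_nonneg fun z => abs_nonneg _
  have hI₂ : 0 ≤ I₂ := integral_nonneg fun z => by positivity
  -- The three contributions: the operator on `u`, the operator on `θ`, and the force term; each 2
  -- is the bound on `|D|`.
  refine ⟨2 * S + 2 * I₁ + I₂, by positivity, ?_⟩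
  intro u M G hu hM hG D ℓ hD hD2 hℓ s hs
  have hM0 : 0 ≤ M := (abs_nonneg _).trans (hM 0)
  have hG0 : 0 ≤ G := (integral_nonneg fun z => abs_nonneg _).trans hG
  have hℓ0 : 0 ≤ ℓ := (norm_nonneg _).trans (hℓ 0)
  have hDc := hD.continuous
  have hDf := hD.continuous_fderiv one_ne_zero
  have huc := hu.continuous
  have hθc' := hθ.continuous
  have hTu : Continuous fun z => fderiv ℝ u z (b z) :=
    (hu.continuous_fderiv one_ne_zero).clm_apply hb
  have hderiv : ∀ t : ℝ, HasDerivAt (fun t : ℝ => ∫ z, u z * θ z * D (z.1 + t • z.2))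
      (∫ z, u z * θ z * fderiv ℝ D (z.1 + t • z.2) z.2) t := by
    intro t
    refine (hasDerivAt_integral_of_dominated_loc_of_deriv_le (𝕜 := ℝ) (s := univ)
      (F := fun (t : ℝ) (z : E d × E d) => u z * θ z * D (z.1 + t • z.2))
      (F' := fun (t : ℝ) (z : E d × E d) => u z * θ z * fderiv ℝ D (z.1 + t • z.2) z.2)
      (bound := fun z => |u z * θ z| * (ℓ * ‖z.2‖)) univ_mem
      (Eventually.of_forall fun t => ?_) ?_ ?_ ?_ ?_ ?_).2
    · exact (show Continuous fun z : E d × E d => u z * θ z * D (z.1 + t • z.2) by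
        fun_prop).aestronglyMeasurable
    · exact integrable_of_continuous_of_radius (R := R) (by fun_prop) fun z hz => by simp [hR z hz]
    · exact ((huc.mul hθc').mul ((hDf.comp (by fun_prop)).clm_apply
        continuous_snd)).aestronglyMeasurable
    · refine Eventually.of_forall fun z t _ => ?_
      rw [norm_mul, Real.norm_eq_abs]
      refine mul_le_mul_of_nonneg_left ?_ (abs_nonneg _)
      exact (ContinuousLinearMap.le_opNorm _ _).trans
        (mul_le_mul_of_nonneg_right (hℓ _) (norm_nonneg _))
    · exact integrable_of_continuous_of_radius (R := R) (by fun_prop) fun z hz => by simp [hR z hz]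
    · refine Eventually.of_forall fun z t _ => ?_
      have h1 : HasDerivAt (fun t : ℝ => z.1 + t • z.2) z.2 t := by
        simpa using ((hasDerivAt_id t).smul_const z.2).const_add z.1
      have h2 := ((hD.differentiable one_ne_zero (z.1 + t • z.2)).hasFDerivAt).comp_hasDerivAt t h1
      exact h2.const_mul _
  have hbound : ∀ t ∈ Ico (0 : ℝ) s, ‖∫ z, u z * θ z * fderiv ℝ D (z.1 + t • z.2) z.2‖ ≤
      (2 * S + 2 * I₁ + I₂) * (M + G) * (1 + s * ℓ) := by
    intro t ht
    have hDt : ContDiff ℝ 1 fun z : E d × E d => D (z.1 + t • z.2) :=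
      hD.comp (contDiff_fst.add (contDiff_snd.const_smul t))
    have hzero := integral_transport_eq_zero hF (p := fun z => u z * θ z * D (z.1 + t • z.2))
      ((hu.mul hθ).mul hDt) (HasCompactSupport.intro (isCompact_closedBall (0 : E d × E d) R)
        fun z hz => by rw [hR z (by simpa using hz)]; ring)
    have hprod : ∀ z, fderiv ℝ (fun z => u z * θ z * D (z.1 + t • z.2)) z (b z) =
        u z * θ z * fderiv ℝ D (z.1 + t • z.2) z.2 +
        (θ z * D (z.1 + t • z.2) * fderiv ℝ u z (b z) +
        (u z * D (z.1 + t • z.2) * fderiv ℝ θ z (b z) +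
        t * (u z * θ z * fderiv ℝ D (z.1 + t • z.2) (F z.1)))) := by
      intro z
      have e1 := (hu.differentiable one_ne_zero z).hasFDerivAt
      have e2 := (hθ.differentiable one_ne_zero z).hasFDerivAt
      have e3 : HasFDerivAt (fun z : E d × E d => z.1 + t • z.2)
          (ContinuousLinearMap.fst ℝ (E d) (E d) + t • ContinuousLinearMap.snd ℝ (E d) (E d)) z :=
        hasFDerivAt_fst.add (hasFDerivAt_snd.const_smul t)
      have e4 : HasFDerivAt (fun z : E d × E d => D (z.1 + t • z.2)) _ z :=
        ((hD.differentiable one_ne_zero (z.1 + t • z.2)).hasFDerivAt).comp z e3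
      have e5 : HasFDerivAt (fun z => u z * θ z * D (z.1 + t • z.2)) _ z := (e1.mul e2).mul e4
      rw [e5.fderiv]
      simp [b]
      ring
    have j0 : Integrable (fun z => u z * θ z * fderiv ℝ D (z.1 + t • z.2) z.2) volume :=
      integrable_of_continuous_of_radius (R := R) ((huc.mul hθc').mul ((hDf.comp (by fun_prop)).clm_apply
        continuous_snd)) fun z hz => by simp [hR z hz]
    have j1 : Integrable (fun z => θ z * D (z.1 + t • z.2) * fderiv ℝ u z (b z)) volume :=
      integrable_of_continuous_of_radius (R := R) (by fun_prop) fun z hz => by simp [hR z hz]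
    have j2 : Integrable (fun z => u z * D (z.1 + t • z.2) * fderiv ℝ θ z (b z)) volume :=
      integrable_of_continuous_of_radius (R := R) (by fun_prop) fun z hz => by simp [hTθ0 z hz]
    have j3 : Integrable (fun z => t * (u z * θ z * fderiv ℝ D (z.1 + t • z.2) (F z.1)))
        volume :=
      integrable_of_continuous_of_radius (R := R) (continuous_const.mul ((huc.mul hθc').mul
        ((hDf.comp (by fun_prop)).clm_apply (by fun_prop)))) fun z hz => by simp [hR z hz]
    simp only [b] at hprod j1 j2
    simp only [hprod] at hzero
    have j23 := integral_add j2 j3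
    have j123 := integral_add j1 (j2.add j3)
    have j0123 := integral_add j0 (j1.add (j2.add j3))
    simp only [Pi.add_apply] at j123 j0123
    rw [j0123, j123, j23] at hzero
    have b1 : |∫ z, θ z * D (z.1 + t • z.2) * fderiv ℝ u z (b z)| ≤ 2 * S * G := by
      have hz : ∀ z, z ∉ closedBall (0 : E d × E d) R →
          θ z * D (z.1 + t • z.2) * fderiv ℝ u z (b z) = 0 := fun z hz => by
        rw [hR z (by simpa using hz)]
        ring
      rw [← setIntegral_eq_integral_of_forall_compl_eq_zero hz]
      calc |∫ z in closedBall 0 R, θ z * D (z.1 + t • z.2) * fderiv ℝ u z (b z)|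
          ≤ ∫ z in closedBall 0 R, S * 2 * |fderiv ℝ u z (b z)| := by
            rw [← Real.norm_eq_abs]
            refine norm_integral_le_of_norm_le ((hTu.abs.continuousOn.integrableOn_compact
              (isCompact_closedBall _ _)).const_mul _) (Eventually.of_forall fun z => ?_)
            rw [norm_mul, norm_mul]
            exact mul_le_mul_of_nonneg_right (mul_le_mul (hS z) (hD2 _) (norm_nonneg _) hS0)
              (norm_nonneg _)
        _ = 2 * S * ∫ z in closedBall 0 R, |fderiv ℝ u z (b z)| := by
            rw [integral_const_mul]
            ring
        _ ≤ 2 * S * G := by gcongr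
    have b2 : |∫ z, u z * D (z.1 + t • z.2) * fderiv ℝ θ z (b z)| ≤ 2 * M * I₁ := by
      calc |∫ z, u z * D (z.1 + t • z.2) * fderiv ℝ θ z (b z)|
          ≤ ∫ z, M * 2 * |fderiv ℝ θ z (b z)| := by
            rw [← Real.norm_eq_abs]
            refine norm_integral_le_of_norm_le (hi1.const_mul _) (Eventually.of_forall fun z => ?_)
            rw [norm_mul, norm_mul]
            exact mul_le_mul_of_nonneg_right (mul_le_mul (hM z) (hD2 _) (norm_nonneg _) hM0)
              (norm_nonneg _)
        _ = 2 * M * I₁ := by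
            rw [integral_const_mul]
            ring
    have b3 : |∫ z, t * (u z * θ z * fderiv ℝ D (z.1 + t • z.2) (F z.1))| ≤ s * M * ℓ * I₂ := by
      calc |∫ z, t * (u z * θ z * fderiv ℝ D (z.1 + t • z.2) (F z.1))|
          ≤ ∫ z : E d × E d, s * M * ℓ * (|θ z| * ‖F z.1‖) := by
            rw [← Real.norm_eq_abs]
            refine norm_integral_le_of_norm_le (hi2.const_mul _) (Eventually.of_forall fun z => ?_)
            rw [norm_mul, norm_mul, norm_mul, Real.norm_of_nonneg ht.1]
            have hop : ‖fderiv ℝ D (z.1 + t • z.2) (F z.1)‖ ≤ ℓ * ‖F z.1‖ :=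
              (ContinuousLinearMap.le_opNorm _ _).trans
                (mul_le_mul_of_nonneg_right (hℓ _) (norm_nonneg _))
            calc t * (‖u z‖ * ‖θ z‖ * ‖fderiv ℝ D (z.1 + t • z.2) (F z.1)‖)
                ≤ s * (M * ‖θ z‖ * (ℓ * ‖F z.1‖)) := by
                  gcongr
                  · exact ht.2.le
                  · exact hM z
              _ = s * M * ℓ * (|θ z| * ‖F z.1‖) := by
                  rw [Real.norm_eq_abs]
                  ring
        _ = s * M * ℓ * I₂ := integral_const_mul _ _
    have heq : ∫ z, u z * θ z * fderiv ℝ D (z.1 + t • z.2) z.2 =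
        -((∫ z, θ z * D (z.1 + t • z.2) * fderiv ℝ u z (b z)) +
        ((∫ z, u z * D (z.1 + t • z.2) * fderiv ℝ θ z (b z)) +
        ∫ z, t * (u z * θ z * fderiv ℝ D (z.1 + t • z.2) (F z.1)))) := by
      simp only [b]
      linarith
    rw [heq, norm_neg, Real.norm_eq_abs]
    refine (abs_add_le _ _).trans ((add_le_add b1 ((abs_add_le _ _).trans
      (add_le_add b2 b3))).trans ?_)
    have hsℓ : 0 ≤ s * ℓ := by positivity
    have k1 : 2 * S * G ≤ 2 * S * ((M + G) * (1 + s * ℓ)) := by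
      gcongr
      nlinarith
    have k2 : 2 * M * I₁ ≤ 2 * I₁ * ((M + G) * (1 + s * ℓ)) := by
      have : M ≤ (M + G) * (1 + s * ℓ) := by nlinarith
      nlinarith
    have k3 : s * M * ℓ * I₂ ≤ I₂ * ((M + G) * (1 + s * ℓ)) := by
      have : s * M * ℓ ≤ (M + G) * (1 + s * ℓ) := by nlinarith
      nlinarith
    linarith
  have hfin := norm_image_sub_le_of_norm_deriv_le_segment'
    (fun t _ => (hderiv t).hasDerivWithinAt) hbound s (right_mem_Icc.2 hs)
  simp only [zero_smul, add_zero, sub_zero, Real.norm_eq_abs] at hfin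
  refine hfin.trans (le_of_eq ?_)
  ring

/-- The change of variable `x ↦ x - s v` takes one factor to `D x`, which leaves the `v`-integral;
the other becomes `D (x + (t - s) v)`, to which `hosc` applies. As `|s| ≤ 1`, the sheared weight
keeps the Lipschitz constant `Λ` in `v`, and its support in `x` at most doubles in radius. -/
theorem abs_integral_mul_shear_le {κ : E d × E d → ℝ} {Λ : ℝ≥0} (hκ : LipschitzWith Λ κ) {R : ℝ}
    (hR : ∀ z, R < ‖z‖ → κ z = 0) {D : E d → ℝ} (hDc : Continuous D)
    (hD2 : ∀ x, |D x| ≤ 2) {c : ℝ}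
    (hosc : ∀ k : E d → ℝ, LipschitzWith Λ k → (∀ v, R < ‖v‖ → k v = 0) → ∀ y σ, σ ≠ 0 →
      |∫ v, k v * D (y + σ • v)| ≤ c / |σ|) {s t : ℝ} (hs : |s| ≤ 1) (hst : t ≠ s) :
    |∫ z, κ z * (D (z.1 + s • z.2) * D (z.1 + t • z.2))| ≤
      2 * volume.real (closedBall (0 : E d) (2 * R)) * c / |t - s| := by
  have hκc := hκ.continuous
  have hz1 : ∀ z : E d × E d, ‖z.1‖ ≤ ‖z‖ := norm_fst_le
  have hz2 : ∀ z : E d × E d, ‖z.2‖ ≤ ‖z‖ := norm_snd_le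
  set q : E d × E d → ℝ := fun z => κ (z.1 - s • z.2, z.2) * (D z.1 * D (z.1 + (t - s) • z.2))
  have hbig : ∀ x v : E d, 2 * R < ‖x‖ → κ (x - s • v, v) = 0 := by
    intro x v hx
    by_contra hne
    have hle : ‖((x - s • v, v) : E d × E d)‖ ≤ R := not_lt.1 fun h => hne (hR _ h)
    have h1 : ‖x - s • v‖ ≤ R := (hz1 (x - s • v, v)).trans hle
    have h2 : ‖v‖ ≤ R := (hz2 (x - s • v, v)).trans hle
    have h3 : ‖s • v‖ ≤ ‖v‖ := by
      rw [norm_smul]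
      exact mul_le_of_le_one_left (norm_nonneg _) hs
    have h4 : ‖x‖ ≤ ‖x - s • v‖ + ‖s • v‖ := by
      simpa using norm_add_le (x - s • v) (s • v)
    linarith
  have hbigv : ∀ x v : E d, R < ‖v‖ → κ (x, v) = 0 := fun x v hv =>
    hR _ (hv.trans_le (hz2 (x, v)))
  have hi : Integrable (fun z : E d × E d => κ z * (D (z.1 + s • z.2) * D (z.1 + t • z.2)))
      volume := integrable_of_continuous_of_radius (R := R) (by fun_prop) fun z hz => by
    simp [hR z hz]
  have hqi : Integrable q volume := by
    refine integrable_of_continuous_of_radius (R := max R (2 * R)) (by fun_prop) fun z hz => ?_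
    simp only [q]
    rcases lt_max_iff.1 (show max R (2 * R) < max ‖z.1‖ ‖z.2‖ from hz) with h | h
    · rw [hbig z.1 z.2 ((le_max_right _ _).trans_lt h), zero_mul]
    · rw [hbigv _ z.2 ((le_max_left _ _).trans_lt h), zero_mul]
  have hshear : ∫ z, κ z * (D (z.1 + s • z.2) * D (z.1 + t • z.2)) = ∫ z, q z := by
    rw [Measure.volume_eq_prod] at hi hqi ⊢
    rw [integral_prod_symm _ hi, integral_prod_symm _ hqi]
    refine integral_congr_ae (Eventually.of_forall fun v => ?_)
    simp only
    rw [← integral_sub_right_eq_self _ (s • v)]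
    refine integral_congr_ae (Eventually.of_forall fun x => ?_)
    simp only [q, sub_add_cancel]
    congr 3
    rw [sub_smul]
    abel
  have hσ : t - s ≠ 0 := sub_ne_zero.2 hst
  have hinner : ∀ x : E d, |∫ v, q (x, v)| ≤
      (closedBall (0 : E d) (2 * R)).indicator (fun _ => 2 * (c / |t - s|)) x := by
    intro x
    by_cases hx : x ∈ closedBall (0 : E d) (2 * R)
    · rw [indicator_of_mem hx]
      have hlip : LipschitzWith Λ fun v => κ (x - s • v, v) := by
        have h1 : LipschitzWith 1 fun v : E d => ((x - s • v, v) : E d × E d) := by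
          refine LipschitzWith.of_dist_le_mul fun v w => ?_
          rw [NNReal.coe_one, one_mul, Prod.dist_eq]
          refine max_le ?_ le_rfl
          simp only [dist_sub_left]
          rw [dist_smul₀]
          exact mul_le_of_le_one_left dist_nonneg hs
        simpa [Function.comp_def] using hκ.comp h1
      have h1 := hosc _ hlip (fun v hv => hbigv _ v hv) x (t - s) hσ
      have h2 : ∫ v, q (x, v) = D x * ∫ v, κ (x - s • v, v) * D (x + (t - s) • v) := by
        rw [← integral_const_mul]
        refine integral_congr_ae (Eventually.of_forall fun v => ?_)
        simp only [q]
        ring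
      rw [h2, abs_mul]
      exact mul_le_mul (hD2 x) h1 (abs_nonneg _) (by norm_num)
    · rw [indicator_of_notMem hx]
      have : ∀ v, q (x, v) = 0 := fun v => by
        simp only [q]
        rw [hbig x v (by simpa using hx), zero_mul]
      simp [this]
  rw [hshear, Measure.volume_eq_prod, integral_prod _ (by rwa [Measure.volume_eq_prod] at hqi)]
  calc |∫ x, ∫ v, q (x, v)|
      ≤ ∫ x, (closedBall (0 : E d) (2 * R)).indicator (fun _ => 2 * (c / |t - s|)) x := by
        rw [← Real.norm_eq_abs]
        refine norm_integral_le_of_norm_le ?_ (Eventually.of_forall hinner)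
        exact (integrable_indicator_iff measurableSet_closedBall).2
          (integrableOn_const (isCompact_closedBall _ _).measure_lt_top.ne)
    _ = _ := by
        rw [integral_indicator measurableSet_closedBall, setIntegral_const, smul_eq_mul]
        ring

/-- When the square is expanded, the `N` diagonal terms get the trivial bound `4 ∫ κ`. Distinct
times are at least `τ / N` apart, so decorrelation bounds each remaining term by a multiple of `c N
/ τ`. -/
theorem integral_mul_sq_average_le {κ : E d × E d → ℝ} {Λ : ℝ≥0} (hκ : LipschitzWith Λ κ)
    (hκ0 : ∀ z, 0 ≤ κ z) {R : ℝ} (hR : ∀ z, R < ‖z‖ → κ z = 0) {D : E d → ℝ}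
    (hDc : Continuous D) (hD2 : ∀ x, |D x| ≤ 2) {c : ℝ} (hc : 0 ≤ c)
    (hosc : ∀ k : E d → ℝ, LipschitzWith Λ k → (∀ v, R < ‖v‖ → k v = 0) → ∀ y σ, σ ≠ 0 →
      |∫ v, k v * D (y + σ • v)| ≤ c / |σ|) {τ : ℝ} (hτ : 0 < τ) (hτ1 : τ ≤ 1) {N : ℕ}
    (hN : 0 < N) :
    ∫ z, κ z * ((N : ℝ)⁻¹ * ∑ j ∈ Finset.range N, D (z.1 + (τ * j / N) • z.2)) ^ 2 ≤
      4 * (∫ z, κ z) / N + 2 * volume.real (closedBall (0 : E d) (2 * R)) * c * N / τ := by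
  have hκc := hκ.continuous
  have hN' : (0 : ℝ) < N := Nat.cast_pos.2 hN
  set σ : ℕ → ℝ := fun j => τ * j / N
  set B : ℝ := 2 * volume.real (closedBall (0 : E d) (2 * R)) * c * N / τ
  have hB : 0 ≤ B := by positivity
  have hκi : Integrable κ volume := integrable_of_continuous_of_radius hκc hR
  have hi : ∀ j l : ℕ, Integrable
      (fun z : E d × E d => κ z * (D (z.1 + σ j • z.2) * D (z.1 + σ l • z.2))) volume :=
    fun j l => integrable_of_continuous_of_radius (R := R) (by fun_prop) fun z hz => by
      simp [hR z hz]
  have hterm : ∀ j ∈ Finset.range N, ∀ l ∈ Finset.range N,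
      ∫ z, κ z * (D (z.1 + σ j • z.2) * D (z.1 + σ l • z.2)) ≤
        (if j = l then 4 * ∫ z, κ z else 0) + B := by
    intro j hj l hl
    rw [Finset.mem_range] at hj hl
    split_ifs with hjl
    · subst hjl
      have : ∫ z, κ z * (D (z.1 + σ j • z.2) * D (z.1 + σ j • z.2)) ≤ ∫ z, κ z * 4 := by
        refine integral_mono (hi j j) (hκi.mul_const 4) fun z => ?_
        refine mul_le_mul_of_nonneg_left ?_ (hκ0 z)
        have := hD2 (z.1 + σ j • z.2)
        rw [abs_le] at this
        nlinarith
      rw [integral_mul_const] at this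
      linarith
    · have hσ1 : |σ j| ≤ 1 := by
        rw [abs_of_nonneg (by positivity)]
        simp only [σ]
        rw [div_le_one hN']
        have : (j : ℝ) ≤ N := by exact_mod_cast hj.le
        nlinarith [(Nat.cast_nonneg j : (0 : ℝ) ≤ j)]
      have hdiff : σ l - σ j = τ / N * ((l : ℝ) - j) := by
        simp only [σ]
        ring
      have hge : τ / N ≤ |σ l - σ j| := by
        rw [hdiff, abs_mul, abs_of_pos (by positivity)]
        refine le_mul_of_one_le_right (by positivity) ?_
        have h1 : (1 : ℤ) ≤ |(l : ℤ) - j| := Int.one_le_abs (by omega)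
        exact_mod_cast h1
      have hpos : 0 < τ / N := by positivity
      have hne : σ l ≠ σ j := fun h => by
        rw [h, sub_self, abs_zero] at hge
        linarith
      have := abs_integral_mul_shear_le hκ hR hDc hD2 hosc hσ1 hne
      refine (le_abs_self _).trans (this.trans ?_)
      rw [zero_add]
      calc 2 * volume.real (closedBall (0 : E d) (2 * R)) * c / |σ l - σ j|
          ≤ 2 * volume.real (closedBall (0 : E d) (2 * R)) * c / (τ / N) := by gcongr
        _ = B := by
            simp only [B]
            field_simp
  have hexp : ∀ z : E d × E d,
      κ z * ((N : ℝ)⁻¹ * ∑ j ∈ Finset.range N, D (z.1 + σ j • z.2)) ^ 2 =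
      ((N : ℝ)⁻¹) ^ 2 * ∑ j ∈ Finset.range N, ∑ l ∈ Finset.range N,
        κ z * (D (z.1 + σ j • z.2) * D (z.1 + σ l • z.2)) := by
    intro z
    simp only [← Finset.mul_sum]
    rw [← Finset.sum_mul]
    ring
  calc ∫ z, κ z * ((N : ℝ)⁻¹ * ∑ j ∈ Finset.range N, D (z.1 + σ j • z.2)) ^ 2
      = ((N : ℝ)⁻¹) ^ 2 * ∑ j ∈ Finset.range N, ∑ l ∈ Finset.range N,
        ∫ z, κ z * (D (z.1 + σ j • z.2) * D (z.1 + σ l • z.2)) := by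
        simp only [hexp]
        rw [integral_const_mul, integral_finsetSum _ fun j _ =>
          integrable_finsetSum _ fun l _ => hi j l]
        simp only [integral_finsetSum _ fun l _ => hi _ l]
    _ ≤ ((N : ℝ)⁻¹) ^ 2 * ∑ j ∈ Finset.range N, ∑ l ∈ Finset.range N,
        ((if j = l then 4 * ∫ z, κ z else 0) + B) := by
        gcongr with j hj l hl
        exact hterm j hj l hl
    _ = ((N : ℝ)⁻¹) ^ 2 * (N * (4 * ∫ z, κ z) + N * (N * B)) := by
        congr 1
        simp only [Finset.sum_add_distrib, Finset.sum_const, Finset.card_range, nsmul_eq_mul]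
        congr 1
        rw [Finset.sum_congr rfl fun j hj => Finset.sum_ite_eq _ _ _]
        rw [Finset.sum_congr rfl fun j hj => if_pos hj]
        simp
    _ = _ := by
        field_simp

/-! ### Dyadic summation and duality. -/

/-- The radii of the successive mollifications. -/
def dyadicRadius (k : ℕ) : ℝ := ((1 / 2 : ℝ) ^ k) ^ 12

theorem dyadicRadius_pos (k : ℕ) : 0 < dyadicRadius k := by
  unfold dyadicRadius
  positivity

theorem dyadicRadius_succ (k : ℕ) : dyadicRadius (k + 1) = dyadicRadius k / 4096 := by
  simp only [dyadicRadius, pow_succ]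
  ring

theorem tendsto_dyadicRadius : Tendsto dyadicRadius atTop (𝓝 0) := by
  have := (tendsto_pow_atTop_nhds_zero_of_lt_one (r := (1 / 2 : ℝ)) (by norm_num)
    (by norm_num)).pow 12
  rw [zero_pow (by norm_num)] at this
  exact this

/-- Write `q = 2⁻ᵏ`. The time window `τ` must be much longer than `N r` for decorrelation and much
shorter than `√r` to keep the force term small. The choice `r = q ^ 12`, `τ = q ^ 8`, `N = q⁻²`
makes the transport error `τ + τ ^ 2 * ℓ` at most of order `q ^ 4`, and the mean square `1 / N + r N
/ τ` of order `q ^ 2`. -/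
theorem exists_bound_dyadic {F : E d → E d} (hF : Continuous F) {θ : E d × E d → ℝ}
    (hθ : ContDiff ℝ 1 θ) {R : ℝ} (hR : ∀ z, R < ‖z‖ → θ z = 0) {η : E d → ℝ}
    (hη : IsMollifier volume η) :
    ∃ C : ℝ, 0 ≤ C ∧ ∀ (u : E d × E d → ℝ) (M G : ℝ), ContDiff ℝ 1 u → (∀ z, |u z| ≤ M) →
      ∫ z in closedBall 0 R, |fderiv ℝ u z (z.2, F z.1)| ≤ G → ∀ h : E d → ℝ, Measurable h →
      (∀ x, |h x| ≤ 1) → ∀ k : ℕ,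
      |∫ z : E d × E d, u z * θ z * (mollify volume η (dyadicRadius (k + 1)) h z.1 -
        mollify volume η (dyadicRadius k) h z.1)| ≤ C * (M + G) * (1 / 2) ^ k := by
  obtain ⟨C₀, hC₀, hfree⟩ := exists_bound_free_transport hF hθ hR
  obtain ⟨L, hL⟩ := ContDiff.lipschitzWith_of_hasCompactSupport hη.hasCompactSupport hη.contDiff
    (by simp)
  obtain ⟨Rη, hRη, hsupp⟩ := exists_radius_of_hasCompactSupport hη.hasCompactSupport
  have hθ2 : ContDiff ℝ 1 fun z => θ z ^ 2 := hθ.pow 2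
  have hR2 : ∀ z, R < ‖z‖ → θ z ^ 2 = 0 := fun z hz => by simp [hR z hz]
  obtain ⟨Λ, hΛ⟩ := ContDiff.lipschitzWith_of_hasCompactSupport (HasCompactSupport.intro
    (isCompact_closedBall (0 : E d × E d) R) fun z hz => hR2 z (by simpa using hz)) hθ2
    one_ne_zero
  have hθ2i : Integrable (fun z => θ z ^ 2) volume :=
    integrable_of_continuous_of_radius hθ2.continuous hR2
  set T : ℝ := ∫ z, θ z ^ 2
  have hT : 0 ≤ T := integral_nonneg fun z => sq_nonneg _
  set Cη : ℝ := 2 * L * volume.real (closedBall (0 : E d) Rη)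
  have hCη : 0 ≤ Cη := by positivity
  -- Twice the constant for one mollification, because `r' + r ≤ 2 * r`.
  set cκ : ℝ := 4 * Λ * volume.real (closedBall (0 : E d) R) * Rη
  have hcκ : 0 ≤ cκ := by positivity
  set VX : ℝ := volume.real (closedBall (0 : E d × E d) R)
  set VE : ℝ := volume.real (closedBall (0 : E d) (2 * R))
  have hVX : 0 ≤ VX := measureReal_nonneg
  have hVE : 0 ≤ VE := measureReal_nonneg
  set CQ : ℝ := 4 * T + 2 * VE * cκ
  have hCQ : 0 ≤ CQ := by positivity
  refine ⟨C₀ * (1 + 8192 * Cη) + (VX + CQ), by positivity, ?_⟩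
  intro u M G hu hM hG h hm hb k
  have hM0 : 0 ≤ M := (abs_nonneg _).trans (hM 0)
  have hG0 : 0 ≤ G := (integral_nonneg fun z => abs_nonneg _).trans hG
  set q : ℝ := (1 / 2 : ℝ) ^ k
  have hq : 0 < q := by positivity
  have hq1 : q ≤ 1 := pow_le_one₀ (by norm_num) (by norm_num)
  have hhl : LocallyIntegrable h volume :=
    (locallyIntegrable_const (1 : ℝ)).mono hm.aestronglyMeasurable
      (Eventually.of_forall fun x => by simpa using hb x)
  set r : ℝ := dyadicRadius k
  set r' : ℝ := dyadicRadius (k + 1)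
  have hr : 0 < r := dyadicRadius_pos k
  have hr' : 0 < r' := dyadicRadius_pos (k + 1)
  have hrr' : r' = r / 4096 := dyadicRadius_succ k
  have hrq : r = q ^ 12 := rfl
  set D : E d → ℝ := fun x => mollify volume η r' h x - mollify volume η r h x
  have hD : ContDiff ℝ 1 D :=
    ((hη.contDiff_mollify hr' hhl).sub (hη.contDiff_mollify hr hhl)).of_le (by simp)
  have hD2 : ∀ x, |D x| ≤ 2 := fun x => by
    refine (abs_sub _ _).trans ?_
    linarith [hη.abs_mollify_le hm hb r' x, hη.abs_mollify_le hm hb r x]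
  -- The two gradients add up to `4097 * Cη / r`, rounded up to `2 * 4096`.
  set ℓ : ℝ := 8192 * Cη / q ^ 12
  have hℓ0 : 0 ≤ ℓ := by positivity
  have hℓ : ∀ x, ‖fderiv ℝ D x‖ ≤ ℓ := by
    intro x
    have hlip : LipschitzWith (Real.toNNReal ℓ) D := by
      refine LipschitzWith.of_dist_le_mul fun x y => ?_
      rw [Real.coe_toNNReal _ hℓ0, Real.dist_eq, dist_eq_norm]
      have e1 := hη.abs_mollify_sub_le hm hb hL hsupp hr'.ne' x y
      have e2 := hη.abs_mollify_sub_le hm hb hL hsupp hr.ne' x y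
      rw [abs_of_pos hr'] at e1
      rw [abs_of_pos hr] at e2
      have e3 : D x - D y = (mollify volume η r' h x - mollify volume η r' h y) -
          (mollify volume η r h x - mollify volume η r h y) := by
        simp only [D]
        ring
      rw [e3]
      refine (abs_sub _ _).trans ((add_le_add e1 e2).trans ?_)
      rw [← add_mul]
      refine mul_le_mul_of_nonneg_right ?_ (norm_nonneg _)
      change Cη / r' + Cη / r ≤ 8192 * Cη / q ^ 12
      rw [hrr', ← hrq, div_div_eq_mul_div, ← add_div]
      gcongr
      linarith
    refine (norm_fderiv_le_of_lipschitz ℝ hlip).trans_eq (Real.coe_toNNReal _ hℓ0)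
  have hosc : ∀ κ : E d → ℝ, LipschitzWith Λ κ → (∀ v, R < ‖v‖ → κ v = 0) → ∀ y σ, σ ≠ 0 →
      |∫ v, κ v * D (y + σ • v)| ≤ cκ * q ^ 12 / |σ| := by
    intro κ hκ hκR y σ hσ
    have e1 := hη.abs_integral_mul_mollify_sub_le hm hb hsupp hκ hκR r' hσ y
    have e2 := hη.abs_integral_mul_mollify_sub_le hm hb hsupp hκ hκR r hσ y
    have hκc : HasCompactSupport κ := HasCompactSupport.intro (isCompact_closedBall (0 : E d) R)
      fun z hz => hκR z (by simpa using hz)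
    have hi : ∀ ρ : ℝ, 0 < ρ →
        Integrable (fun v => κ v * mollify volume η ρ h (y + σ • v)) volume := fun ρ hρ =>
      (hκ.continuous.mul ((hη.contDiff_mollify hρ hhl).continuous.comp
        (by fun_prop))).integrable_of_hasCompactSupport hκc.mul_right
    have e3 : ∫ v, κ v * D (y + σ • v) =
        ((∫ v, κ v * mollify volume η r' h (y + σ • v)) - ∫ v, κ v * h (y + σ • v)) -
        ((∫ v, κ v * mollify volume η r h (y + σ • v)) - ∫ v, κ v * h (y + σ • v)) := by
      rw [sub_sub_sub_cancel_right, ← integral_sub (hi r' hr') (hi r hr)]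
      simp only [D, mul_sub]
    rw [e3]
    refine (abs_sub _ _).trans ((add_le_add e1 e2).trans ?_)
    rw [abs_of_pos hr, abs_of_pos hr', ← add_div, ← hrq, ← mul_add]
    have : 2 * (Λ : ℝ) * volume.real (closedBall (0 : E d) R) * Rη * (r' + r) ≤ cκ * r := by
      have hle : r' + r ≤ 2 * r := by linarith
      calc 2 * (Λ : ℝ) * volume.real (closedBall (0 : E d) R) * Rη * (r' + r)
          ≤ 2 * (Λ : ℝ) * volume.real (closedBall (0 : E d) R) * Rη * (2 * r) := by gcongr
        _ = cκ * r := by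
            simp only [cκ]
            ring
    gcongr
  set N : ℕ := 4 ^ k
  have hN : 0 < N := by positivity
  have hN' : (0 : ℝ) < N := Nat.cast_pos.2 hN
  have hNq : (N : ℝ) = (q ^ 2)⁻¹ := by
    simp only [N, q, ← pow_mul, mul_comm k 2]
    rw [pow_mul, ← inv_pow]
    norm_num
  set τ : ℝ := q ^ 8
  have hτ : 0 < τ := by positivity
  have hτ1 : τ ≤ 1 := pow_le_one₀ hq.le hq1
  have hDc := hD.continuous
  have huc := hu.continuous
  have hθc := hθ.continuous
  set avg : E d × E d → ℝ := fun z =>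
    (N : ℝ)⁻¹ * ∑ j ∈ Finset.range N, D (z.1 + (τ * j / N) • z.2)
  have havgc : Continuous avg := by fun_prop
  have hQ : ∫ z, θ z ^ 2 * avg z ^ 2 ≤ CQ * q ^ 2 := by
    refine (integral_mul_sq_average_le hΛ (fun z => sq_nonneg _) hR2 hDc hD2 (by positivity) hosc
      hτ hτ1 hN).trans (le_of_eq ?_)
    rw [hNq]
    simp only [CQ, τ, T, VE]
    field_simp
  have hi0 : ∀ s : ℝ, Integrable (fun z : E d × E d => u z * θ z * D (z.1 + s • z.2)) volume :=
    fun s => integrable_of_continuous_of_radius (R := R) (by fun_prop) fun z hz => by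
      simp [hR z hz]
  have hmean : ∫ z, u z * θ z * avg z =
      (N : ℝ)⁻¹ * ∑ j ∈ Finset.range N, ∫ z, u z * θ z * D (z.1 + (τ * j / N) • z.2) := by
    rw [← integral_finsetSum _ fun j _ => hi0 _, ← integral_const_mul]
    refine integral_congr_ae (Eventually.of_forall fun z => ?_)
    simp only [avg, ← Finset.mul_sum]
    ring
  have hdiff : |(∫ z, u z * θ z * avg z) - ∫ z, u z * θ z * D z.1| ≤
      C₀ * (M + G) * ((1 + 8192 * Cη) * q) := by
    have hconst : ∫ z, u z * θ z * D z.1 =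
        (N : ℝ)⁻¹ * ∑ j ∈ Finset.range N, ∫ z, u z * θ z * D z.1 := by
      rw [Finset.sum_const, Finset.card_range, nsmul_eq_mul, inv_mul_cancel_left₀ hN'.ne']
    rw [hmean, hconst, ← mul_sub, ← Finset.sum_sub_distrib, abs_mul,
      abs_of_pos (inv_pos.2 hN'), inv_mul_le_iff₀ hN']
    refine (Finset.abs_sum_le_sum_abs _ _).trans ?_
    have : ∀ j ∈ Finset.range N, |(∫ z, u z * θ z * D (z.1 + (τ * j / N) • z.2)) -
        ∫ z, u z * θ z * D z.1| ≤ C₀ * (M + G) * ((1 + 8192 * Cη) * q) := by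
      intro j hj
      have hjN : (j : ℝ) ≤ N := by exact_mod_cast (Finset.mem_range.1 hj).le
      have hs0 : 0 ≤ τ * j / N := by positivity
      have hs1 : τ * j / N ≤ τ := by
        rw [div_le_iff₀ hN']
        gcongr
      refine (hfree u M G hu hM hG D ℓ hD hD2 hℓ _ hs0).trans ?_
      refine mul_le_mul_of_nonneg_left ?_ (by positivity)
      have h1 : τ * j / N + (τ * j / N) ^ 2 * ℓ ≤ τ + τ ^ 2 * ℓ := by gcongr
      have h2 : τ ^ 2 * ℓ = 8192 * Cη * q ^ 4 := by
        simp only [τ, ℓ]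
        field_simp
      have h3 : τ ≤ q := pow_le_of_le_one hq.le hq1 (by norm_num)
      have h4 : q ^ 4 ≤ q := pow_le_of_le_one hq.le hq1 (by norm_num)
      have h5 : 8192 * Cη * q ^ 4 ≤ 8192 * Cη * q := by gcongr
      linarith
    refine (Finset.sum_le_sum this).trans_eq ?_
    rw [Finset.sum_const, Finset.card_range, nsmul_eq_mul]
  have hsq : Integrable (fun z => θ z ^ 2 * avg z ^ 2) volume :=
    integrable_of_continuous_of_radius (R := R) (by fun_prop) fun z hz => by simp [hR z hz]
  have hmain : |∫ z, u z * θ z * avg z| ≤ M * ((VX + CQ) * q) := by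
    have hind : Integrable ((closedBall (0 : E d × E d) R).indicator fun _ => q) volume :=
      (integrable_indicator_iff measurableSet_closedBall).2
        (integrableOn_const (isCompact_closedBall _ _).measure_lt_top.ne)
    -- On the ball `a ≤ q + a ^ 2 / q`; the weight `q` balances a mean square of order `q ^ 2`.
    calc |∫ z, u z * θ z * avg z|
        ≤ ∫ z, M * ((closedBall (0 : E d × E d) R).indicator (fun _ => q) z +
            q⁻¹ * (θ z ^ 2 * avg z ^ 2)) := by
          rw [← Real.norm_eq_abs]
          refine norm_integral_le_of_norm_le ((hind.add (hsq.const_mul _)).const_mul M)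
            (Eventually.of_forall fun z => ?_)
          rw [mul_assoc, norm_mul]
          refine mul_le_mul (hM z) ?_ (norm_nonneg _) hM0
          by_cases hz : z ∈ closedBall (0 : E d × E d) R
          · rw [indicator_of_mem hz, Real.norm_eq_abs, ← mul_pow, ← sq_abs (θ z * avg z)]
            set a := |θ z * avg z|
            have ha : 0 ≤ a := abs_nonneg _
            rw [← sub_nonneg, show q + q⁻¹ * a ^ 2 - a = q⁻¹ * (q ^ 2 - q * a + a ^ 2) by
              field_simp
              ring]
            have : 0 ≤ q ^ 2 - q * a + a ^ 2 := by nlinarith [sq_nonneg (q - a)]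
            positivity
          · rw [hR z (by simpa using hz), indicator_of_notMem hz]
            simp
      _ = M * (VX * q + q⁻¹ * ∫ z, θ z ^ 2 * avg z ^ 2) := by
          rw [integral_const_mul, integral_add hind (hsq.const_mul _), integral_const_mul,
            integral_indicator measurableSet_closedBall, setIntegral_const, smul_eq_mul]
      _ ≤ M * (VX * q + q⁻¹ * (CQ * q ^ 2)) := by gcongr
      _ = M * ((VX + CQ) * q) := by
          field_simp
  change |∫ z, u z * θ z * D z.1| ≤ _
  have htri : |∫ z, u z * θ z * D z.1| ≤ |∫ z, u z * θ z * avg z| +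
      |(∫ z, u z * θ z * avg z) - ∫ z, u z * θ z * D z.1| := by
    have := abs_sub_abs_le_abs_sub (∫ z, u z * θ z * D z.1) (∫ z, u z * θ z * avg z)
    rw [abs_sub_comm] at this
    linarith
  refine htri.trans ((add_le_add hmain hdiff).trans ?_)
  have hMG : M * ((VX + CQ) * q) ≤ (M + G) * ((VX + CQ) * q) := by
    gcongr
    linarith
  linarith

theorem mollify_const_mul (η : E d → ℝ) (r c : ℝ) (h : E d → ℝ) (x : E d) :
    mollify volume η r (fun y => c * h y) x = c * mollify volume η r h x := by
  rw [mollify, mollify, ← integral_const_mul]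
  refine integral_congr_ae (Eventually.of_forall fun z => ?_)
  simp only
  ring

/-- The dyadic bound is uniform over `|h| ≤ 1`, so summing it controls the `L¹` distance between `w
= ∫ u θ dv` and its transposed mollification at radius `r`. The latter is Lipschitz with a constant
depending only on `r` and the sup bound of `w`. -/
theorem exists_lipschitz_approximation {F : E d → E d} (hF : Continuous F) {θ : E d × E d → ℝ}
    (hθ : ContDiff ℝ 1 θ) {R : ℝ} (hR : ∀ z, R < ‖z‖ → θ z = 0) {M G ε : ℝ} (hM0 : 0 ≤ M)
    (hG0 : 0 ≤ G) (hε : 0 < ε) :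
    ∃ (C : ℝ) (L : ℝ≥0), ∀ u : E d × E d → ℝ, ContDiff ℝ 1 u → (∀ z, |u z| ≤ M) →
      ∫ z in closedBall 0 R, |fderiv ℝ u z (z.2, F z.1)| ≤ G →
      ∃ q : E d → ℝ, (∀ x, |q x| ≤ C) ∧ LipschitzWith L q ∧
        Integrable (fun x => (∫ v, u (x, v) * θ (x, v)) - q x) volume ∧
        ∫ x, |(∫ v, u (x, v) * θ (x, v)) - q x| ≤ ε := by
  obtain ⟨η, hη⟩ := exists_isMollifier (volume : Measure (E d))
  obtain ⟨C₀, hC₀, hdyad⟩ := exists_bound_dyadic hF hθ hR hη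
  obtain ⟨L, hL⟩ := ContDiff.lipschitzWith_of_hasCompactSupport hη.hasCompactSupport hη.contDiff
    (by simp)
  obtain ⟨Rη, hRη, hsupp⟩ := exists_radius_of_hasCompactSupport hη.hasCompactSupport
  have hθcs : HasCompactSupport θ := HasCompactSupport.intro
    (isCompact_closedBall (0 : E d × E d) R) fun z hz => hR z (by simpa using hz)
  obtain ⟨S, hS⟩ := hθcs.exists_bound_of_continuous hθ.continuous
  have hS0 : 0 ≤ S := (norm_nonneg _).trans (hS 0)
  set Q : ℝ := C₀ * (M + G)
  have hQ : 0 ≤ Q := by positivity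
  obtain ⟨k, hk⟩ : ∃ k : ℕ, 2 * Q * (1 / 2 : ℝ) ^ k ≤ ε := by
    have := (tendsto_pow_atTop_nhds_zero_of_lt_one (r := (1 / 2 : ℝ)) (by norm_num)
      (by norm_num)).const_mul (2 * Q)
    rw [mul_zero] at this
    obtain ⟨k, hk⟩ := ((tendsto_order.1 this).2 ε hε).exists
    exact ⟨k, hk.le⟩
  set r : ℝ := dyadicRadius k
  have hr : 0 < r := dyadicRadius_pos k
  -- The added 1 keeps `b` positive, so that `w / b` is a legitimate function bounded by one.
  set b : ℝ := M * S * volume.real (closedBall (0 : E d) R) + 1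
  have hb : 0 < b := by positivity
  set Λ : ℝ := b * (2 * L * volume.real (closedBall (0 : E d) Rη) / r)
  have hΛ : 0 ≤ Λ := by positivity
  refine ⟨b, Real.toNNReal Λ, fun u hu hM hG => ?_⟩
  have huc := hu.continuous
  have hθc := hθ.continuous
  set w : E d → ℝ := fun x => ∫ v, u (x, v) * θ (x, v)
  have hset : ∀ x, w x = ∫ v in closedBall 0 R, u (x, v) * θ (x, v) := fun x => by
    refine (setIntegral_eq_integral_of_forall_compl_eq_zero fun v hv => ?_).symm
    rw [hR (x, v), mul_zero]
    exact (by simpa using hv : R < ‖v‖).trans_le (norm_snd_le (x, v))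
  have hwc : Continuous w := by
    have : Continuous fun x => ∫ v in closedBall (0 : E d) R, u (x, v) * θ (x, v) :=
      continuous_parametric_integral_of_continuous (by fun_prop) (isCompact_closedBall _ _)
    exact this.congr fun x => (hset x).symm
  have hw0 : ∀ x, R < ‖x‖ → w x = 0 := fun x hx => by
    have : ∀ v, u (x, v) * θ (x, v) = 0 := fun v => by
      rw [hR (x, v) (hx.trans_le (norm_fst_le (x, v))), mul_zero]
    simp [w, this]
  have hwb : ∀ x, |w x| ≤ b := fun x => by
    rw [hset x, ← Real.norm_eq_abs]
    refine (norm_setIntegral_le_of_norm_le_const (C := M * S)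
      (isCompact_closedBall _ _).measure_lt_top fun v _ => ?_).trans (by simp [b])
    rw [norm_mul]
    exact mul_le_mul (hM _) (hS _) (norm_nonneg _) hM0
  have hwi : Integrable w volume := hwc.integrable_of_hasCompactSupport
    (HasCompactSupport.intro (isCompact_closedBall (0 : E d) R) fun x hx =>
      hw0 x (by simpa using hx))
  set w' : E d → ℝ := fun x => b⁻¹ * w x
  have hw'm : Measurable w' := (hwc.measurable).const_mul _
  have hw'b : ∀ x, |w' x| ≤ 1 := fun x => by
    simp only [w', abs_mul, abs_of_pos (inv_pos.2 hb)]
    rw [inv_mul_le_iff₀ hb, mul_one]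
    exact hwb x
  have hww' : w = fun x => b * w' x := by
    ext x
    simp only [w']
    rw [mul_inv_cancel_left₀ hb.ne']
  -- The radius is `-r` because mollification of `h` at radius `r` is transposed onto `w`.
  set q : E d → ℝ := mollify volume η (-r) w
  have hqw' : ∀ x, q x = b * mollify volume η (-r) w' x := fun x => by
    simp only [q]
    rw [hww', mollify_const_mul]
  have hqlip : LipschitzWith (Real.toNNReal Λ) q := by
    refine LipschitzWith.of_dist_le_mul fun x y => ?_
    rw [Real.coe_toNNReal _ hΛ, Real.dist_eq, dist_eq_norm, hqw', hqw', ← mul_sub, abs_mul,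
      abs_of_pos hb, mul_assoc]
    refine mul_le_mul_of_nonneg_left ?_ hb.le
    have := hη.abs_mollify_sub_le hw'm hw'b hL hsupp (neg_ne_zero.2 hr.ne') x y
    rwa [abs_neg, abs_of_pos hr] at this
  have hqi : Integrable q volume := by
    refine hqlip.continuous.integrable_of_hasCompactSupport (HasCompactSupport.intro
      (isCompact_closedBall (0 : E d) (R + r * Rη)) fun x hx => ?_)
    have hx' : R + r * Rη < ‖x‖ := by simpa using hx
    have : ∀ z, η z * w (x - (-r) • z) = 0 := by
      intro z
      by_cases hz : Rη < ‖z‖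
      · rw [hsupp z hz, zero_mul]
      · rw [hw0, mul_zero]
        have h1 : ‖x‖ ≤ ‖x - (-r) • z‖ + ‖(-r) • z‖ := by
          simpa using norm_add_le (x - (-r) • z) ((-r) • z)
        have h2 : ‖(-r) • z‖ ≤ r * Rη := by
          rw [norm_smul, norm_neg, Real.norm_of_nonneg hr.le]
          exact mul_le_mul_of_nonneg_left (not_lt.1 hz) hr.le
        linarith
    simp only [q, mollify, this, integral_zero]
  refine ⟨q, fun x => ?_, hqlip, hwi.sub hqi, ?_⟩
  · rw [hqw', abs_mul, abs_of_pos hb]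
    exact mul_le_of_le_one_right hb.le (hη.abs_mollify_le hw'm hw'b _ x)
  -- Pairing with the sign of `w - q` recovers the `L¹` norm; `h` depends on `u`, which uniformity
  -- in `h` permits.
  set h : E d → ℝ := fun x => if 0 ≤ w x - q x then 1 else -1
  have hm : Measurable h := Measurable.ite
    (measurableSet_le measurable_const (hwc.sub hqlip.continuous).measurable)
    measurable_const measurable_const
  have hb1 : ∀ x, |h x| ≤ 1 := fun x => by
    simp only [h]
    split_ifs <;> simp
  have hhl : LocallyIntegrable h volume :=
    (locallyIntegrable_const (1 : ℝ)).mono hm.aestronglyMeasurable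
      (Eventually.of_forall fun x => by simpa using hb1 x)
  set a : ℕ → ℝ := fun n => ∫ x, w x * mollify volume η (dyadicRadius n) h x
  have hmc : ∀ n, Continuous (mollify volume η (dyadicRadius n) h) := fun n =>
    (hη.contDiff_mollify (dyadicRadius_pos n) hhl).continuous
  have hai : ∀ n, Integrable (fun x => w x * mollify volume η (dyadicRadius n) h x) volume :=
    fun n => hwi.mul_bdd (c := 1) (hmc n).aestronglyMeasurable
      (Eventually.of_forall fun x => hη.abs_mollify_le hm hb1 _ x)
  have hstep : ∀ n, |a (n + 1) - a n| ≤ Q * (1 / 2) ^ n := by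
    intro n
    have := hdyad u M G hu hM hG h hm hb1 n
    refine le_trans (le_of_eq ?_) this
    congr 1
    simp only [a]
    have hc1 := hmc (n + 1)
    have hc0 := hmc n
    have hint : Integrable (fun z : E d × E d => u z * θ z *
        (mollify volume η (dyadicRadius (n + 1)) h z.1 -
          mollify volume η (dyadicRadius n) h z.1)) volume :=
      integrable_of_continuous_of_radius (R := R) (by fun_prop) fun z hz => by simp [hR z hz]
    rw [← integral_sub (hai _) (hai _), Measure.volume_eq_prod,
      integral_prod _ (by rwa [Measure.volume_eq_prod] at hint)]
    refine integral_congr_ae (Eventually.of_forall fun x => ?_)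
    simp only
    rw [integral_mul_const, ← mul_sub]
  -- The subtracted tail is the exact partial geometric sum, which lets the induction close.
  have hsum : ∀ n, |a (k + n) - a k| ≤ 2 * Q * ((1 / 2) ^ k - (1 / 2) ^ (k + n)) := by
    intro n
    induction n with
    | zero => simp
    | succ n ih =>
      have h1 : a (k + (n + 1)) - a k = (a (k + n + 1) - a (k + n)) + (a (k + n) - a k) := by
        rw [← add_assoc]
        ring
      rw [h1]
      refine (abs_add_le _ _).trans ((add_le_add (hstep (k + n)) ih).trans (le_of_eq ?_))
      rw [← add_assoc, pow_succ _ (k + n)]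
      ring
  have hlim : Tendsto a atTop (𝓝 (∫ x, w x * h x)) := by
    refine tendsto_integral_of_dominated_convergence (fun x => |w x|)
      (fun n => (hai n).aestronglyMeasurable) hwi.abs (fun n => ?_) ?_
    · refine Eventually.of_forall fun x => ?_
      rw [norm_mul]
      exact mul_le_of_le_one_right (norm_nonneg _) (hη.abs_mollify_le hm hb1 _ x)
    · filter_upwards [hη.ae_tendsto_mollify hhl dyadicRadius_pos tendsto_dyadicRadius] with x hx
      exact hx.const_mul _
  have hlim' : Tendsto (fun n => |a (k + n) - a k|) atTop (𝓝 |(∫ x, w x * h x) - a k|) := by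
    have : Tendsto (fun n => a (k + n)) atTop (𝓝 (∫ x, w x * h x)) := by
      simpa [add_comm] using (tendsto_add_atTop_iff_nat k).2 hlim
    exact (this.sub_const _).abs
  have hfinal : |(∫ x, w x * h x) - a k| ≤ 2 * Q * (1 / 2) ^ k := by
    refine le_of_tendsto hlim' (Eventually.of_forall fun n => (hsum n).trans ?_)
    refine mul_le_mul_of_nonneg_left ?_ (by positivity)
    have : (0 : ℝ) ≤ (1 / 2) ^ (k + n) := by positivity
    linarith
  have hadj : a k = ∫ x, q x * h x := hη.integral_mul_mollify hm hb1 hwi hwc.measurable r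
  have hih : ∀ p : E d → ℝ, Integrable p volume → Integrable (fun x => p x * h x) volume :=
    fun p hp => hp.mul_bdd (c := 1) hm.aestronglyMeasurable (Eventually.of_forall hb1)
  have habs : ∫ x, |w x - q x| = (∫ x, w x * h x) - a k := by
    rw [hadj, ← integral_sub (hih w hwi) (hih q hqi)]
    refine integral_congr_ae (Eventually.of_forall fun x => ?_)
    simp only [h, ← sub_mul]
    split_ifs with hx
    · rw [abs_of_nonneg hx, mul_one]
    · rw [abs_of_neg (not_le.1 hx), mul_neg_one]
  change ∫ x, |w x - q x| ≤ ε
  rw [habs]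
  exact (le_abs_self _).trans (hfinal.trans hk)

/-! ### Compactness in `L1loc`. -/

theorem L1loc.dist_restrict (K : Compacts (E d)) (u : L1loc d)
    (y : Lp ℝ 1 (volume.restrict (K : Set (E d)))) :
    dist (L1loc.restrict K u) y = ∫ x in (K : Set (E d)), |u.1 x - y x| := by
  rw [dist_eq_norm, L1.norm_eq_integral_norm]
  refine integral_congr_ae ?_
  filter_upwards [Lp.coeFn_sub (L1loc.restrict K u) y,
    (u.2.integrableOn_isCompact K.isCompact).coeFn_toL1] with x h1 h2
  rw [h1, Pi.sub_apply, L1loc.restrict, h2, Real.norm_eq_abs]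

theorem L1loc.coeFn_mk {u : E d → ℝ} (hu : LocallyIntegrable u volume) :
    (L1loc.mk u hu).1 =ᵐ[volume] u :=
  AEEqFun.coeFn_mk u hu.aestronglyMeasurable

theorem L1loc.coeFn_restrict (K : Compacts (E d)) (u : L1loc d) :
    L1loc.restrict K u =ᵐ[volume.restrict (K : Set (E d))] u.1 :=
  (u.2.integrableOn_isCompact K.isCompact).coeFn_toL1

theorem L1loc.dist_restrict_mk (K : Compacts (E d)) {u w : E d → ℝ}
    (hu : LocallyIntegrable u volume) (hw : LocallyIntegrable w volume) :
    dist (L1loc.restrict K (L1loc.mk u hu)) (L1loc.restrict K (L1loc.mk w hw)) =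
      ∫ x in (K : Set (E d)), |u x - w x| := by
  rw [L1loc.dist_restrict]
  refine integral_congr_ae ?_
  filter_upwards [L1loc.coeFn_restrict K (L1loc.mk w hw), ae_restrict_of_ae (L1loc.coeFn_mk hu),
    ae_restrict_of_ae (L1loc.coeFn_mk hw)] with x h1 h2 h3
  rw [h1, h2, h3]

theorem L1loc.continuous_restrict (K : Compacts (E d)) : Continuous (L1loc.restrict K) :=
  continuous_iInf_dom (i := K) continuous_induced_dom

/-- Limits on different compact sets of one filter on `L1loc` are compatible. -/
theorem L1loc.ae_eq_of_tendsto {l : Filter (L1loc d)} [l.NeBot] {K K' : Compacts (E d)}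
    (hKK' : (K : Set (E d)) ⊆ K') {y : Lp ℝ 1 (volume.restrict (K : Set (E d)))}
    {y' : Lp ℝ 1 (volume.restrict (K' : Set (E d)))}
    (hy : Tendsto (L1loc.restrict K) l (𝓝 y)) (hy' : Tendsto (L1loc.restrict K') l (𝓝 y')) :
    y' =ᵐ[volume.restrict (K : Set (E d))] y := by
  have hmono : volume.restrict (K : Set (E d)) ≤ volume.restrict (K' : Set (E d)) :=
    Measure.restrict_mono_set _ hKK'
  have hi' : Integrable y' (volume.restrict (K : Set (E d))) :=
    (L1.integrable_coeFn y').mono_measure hmono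
  have hi : Integrable y (volume.restrict (K : Set (E d))) := L1.integrable_coeFn y
  have hle : ∫ x in (K : Set (E d)), |y' x - y x| ≤ 0 := by
    refine le_of_forall_pos_le_add fun ε hε => ?_
    obtain ⟨u, hu, hu'⟩ := ((Metric.tendsto_nhds.1 hy (ε / 2) (half_pos hε)).and
      (Metric.tendsto_nhds.1 hy' (ε / 2) (half_pos hε))).exists
    rw [L1loc.dist_restrict] at hu hu'
    have hui : Integrable u.1 (volume.restrict (K : Set (E d))) :=
      u.2.integrableOn_isCompact K.isCompact
    have hui' : Integrable u.1 (volume.restrict (K' : Set (E d))) :=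
      u.2.integrableOn_isCompact K'.isCompact
    have h1 : ∫ x in (K : Set (E d)), |u.1 x - y' x| ≤
        ∫ x in (K' : Set (E d)), |u.1 x - y' x| :=
      integral_mono_measure hmono (Eventually.of_forall fun x => abs_nonneg _)
        (hui'.sub (L1.integrable_coeFn y')).abs
    calc ∫ x in (K : Set (E d)), |y' x - y x|
        ≤ ∫ x in (K : Set (E d)), (|u.1 x - y' x| + |u.1 x - y x|) := by
          refine integral_mono (hi'.sub hi).abs ((hui.sub hi').abs.add (hui.sub hi).abs)
            fun x => ?_
          simp only
          rw [abs_sub_comm (u.1 x) (y' x)]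
          exact abs_sub_le _ _ _
      _ = _ := integral_add (hui.sub hi').abs (hui.sub hi).abs
      _ ≤ 0 + ε := by linarith
  have hzero : ∫ x in (K : Set (E d)), |y' x - y x| = 0 :=
    le_antisymm hle (integral_nonneg fun x => abs_nonneg _)
  have hae := (integral_eq_zero_iff_of_nonneg (fun x => abs_nonneg _) (hi'.sub hi).abs).1 hzero
  filter_upwards [hae] with x hx
  simpa [sub_eq_zero] using hx

theorem L1loc.exists_of_compatible
    (y : ∀ K : Compacts (E d), Lp ℝ 1 (volume.restrict (K : Set (E d))))
    (hy : ∀ K K' : Compacts (E d), (K : Set (E d)) ⊆ K' →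
      y K' =ᵐ[volume.restrict (K : Set (E d))] y K) :
    ∃ U : L1loc d, ∀ K, L1loc.restrict K U = y K := by
  set B : ℕ → Compacts (E d) := fun n => ⟨closedBall 0 n, isCompact_closedBall _ _⟩
  -- The value at `x` is read on the smallest ball of integer radius containing `x`; compatibility
  -- identifies it a.e. with the value on any larger one.
  set w : E d → ℝ := fun x => y (B ⌈‖x‖⌉₊) x
  have hw : ∀ m : ℕ, w =ᵐ[volume.restrict (closedBall (0 : E d) (m : ℝ))] y (B m) := by
    intro m
    have hall : ∀ᵐ x, ∀ n : ℕ, n ≤ m → x ∈ closedBall (0 : E d) (n : ℝ) → y (B m) x = y (B n) x := by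
      rw [ae_all_iff]
      intro n
      by_cases hnm : n ≤ m
      · have := hy (B n) (B m) (closedBall_subset_closedBall (by exact_mod_cast hnm))
        rw [Filter.EventuallyEq, ae_restrict_iff' (B n).isCompact.measurableSet] at this
        filter_upwards [this] with x hx _ using hx
      · exact Eventually.of_forall fun x h => absurd h hnm
    rw [Filter.EventuallyEq, ae_restrict_iff' measurableSet_closedBall]
    filter_upwards [hall] with x hx hxm
    refine (hx _ (Nat.ceil_le.2 ?_) ?_).symm
    · simpa using hxm
    · simpa using Nat.le_ceil ‖x‖
  have hwi : ∀ m : ℕ, IntegrableOn w (closedBall (0 : E d) (m : ℝ)) volume := fun m =>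
    Integrable.congr (L1.integrable_coeFn (y (B m))) (hw m).symm
  have hwl : LocallyIntegrable w volume := by
    intro x
    obtain ⟨m, hm⟩ := exists_nat_gt ‖x‖
    exact ⟨closedBall 0 m, closedBall_mem_nhds_of_mem (by simpa using hm), hwi m⟩
  refine ⟨L1loc.mk w hwl, fun K => ?_⟩
  refine Lp.ext ?_
  obtain ⟨m, hm⟩ : ∃ m : ℕ, (K : Set (E d)) ⊆ closedBall 0 (m : ℝ) := by
    obtain ⟨R, hR⟩ := K.isCompact.isBounded.subset_closedBall (0 : E d)
    obtain ⟨m, hm⟩ := exists_nat_ge R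
    exact ⟨m, hR.trans (closedBall_subset_closedBall hm)⟩
  filter_upwards [L1loc.coeFn_restrict K (L1loc.mk w hwl), ae_restrict_of_ae (L1loc.coeFn_mk hwl),
    ae_restrict_of_ae_restrict_of_subset hm (hw m), hy K (B m) hm] with x h1 h2 h3 h4
  rw [h1, h2, h3, h4]

/-- An ultrafilter on `C` converges after restriction to each compact set. The limits are
compatible, hence glue to one element of `L1loc`, and convergence of all restrictions is convergence
because the topology is the initial one. -/
theorem L1loc.isCompact_closure {s : Set (L1loc d)}
    (hs : ∀ K : Compacts (E d), TotallyBounded (L1loc.restrict K '' s)) :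
    IsCompact (closure s) := by
  have hcomp : ∀ K : Compacts (E d), IsCompact (closure (L1loc.restrict K '' s)) := fun K =>
    (hs K).closure.isCompact_of_isClosed isClosed_closure
  set C : Set (L1loc d) := {u | ∀ K, L1loc.restrict K u ∈ closure (L1loc.restrict K '' s)}
  have hC : IsCompact C := by
    rw [isCompact_iff_ultrafilter_le_nhds]
    intro 𝒰 h𝒰
    have hlim : ∀ K : Compacts (E d), ∃ y ∈ closure (L1loc.restrict K '' s),
        Tendsto (L1loc.restrict K) 𝒰 (𝓝 y) := by
      intro K
      refine isCompact_iff_ultrafilter_le_nhds.1 (hcomp K) (𝒰.map (L1loc.restrict K)) ?_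
      rw [le_principal_iff] at h𝒰 ⊢
      exact mem_of_superset (x := C) h𝒰 fun u hu => hu K
    choose y hyc hyl using hlim
    obtain ⟨U, hU⟩ := L1loc.exists_of_compatible y fun K K' h =>
      L1loc.ae_eq_of_tendsto h (hyl K) (hyl K')
    refine ⟨U, fun K => (hU K).symm ▸ hyc K, ?_⟩
    rw [nhds_iInf]
    refine le_iInf fun K => ?_
    rw [nhds_induced, ← map_le_iff_le_comap, hU K]
    exact hyl K
  have hCc : IsClosed C := by
    rw [show C = ⋂ K, L1loc.restrict K ⁻¹' closure (L1loc.restrict K '' s) by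
      ext u
      simp [C]]
    exact isClosed_iInter fun K => isClosed_closure.preimage (L1loc.continuous_restrict K)
  refine hC.of_isClosed_subset isClosed_closure (closure_minimal (fun u hu K => ?_) hCc)
  exact subset_closure (mem_image_of_mem _ hu)

/-- A quantitative Arzelà–Ascoli argument: each `q i` is encoded by its values on a finite net of
`K`, rounded to multiples of `e`. There are finitely many codes, and equal codes force the functions
within `(2 * L + 1) * e` on `K`. -/
theorem totallyBounded_of_lipschitz_approximation {ι : Type*} (K : Compacts (E d))
    {ρ : ι → E d → ℝ} (hρ : ∀ i, LocallyIntegrable (ρ i) volume)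
    (happ : ∀ ε, 0 < ε → ∃ (C : ℝ) (L : ℝ≥0), ∀ i, ∃ q : E d → ℝ, (∀ x, |q x| ≤ C) ∧
      LipschitzWith L q ∧ ∫ x in (K : Set (E d)), |ρ i x - q x| ≤ ε) :
    TotallyBounded (L1loc.restrict K '' range fun i => L1loc.mk (ρ i) (hρ i)) := by
  refine Metric.totallyBounded_of_finite_discretization fun ε hε => ?_
  obtain ⟨C, L, hq⟩ := happ (ε / 4) (by positivity)
  choose q hqC hqL hqρ using hq
  set V : ℝ := volume.real (K : Set (E d))
  have hV : 0 ≤ V := measureReal_nonneg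
  -- Chosen so that a uniform error `(2 * L + 1) * e` on `K` integrates to at most `ε / 4`.
  set e : ℝ := ε / (4 * (V + 1) * (2 * L + 1))
  have he : 0 < e := by positivity
  obtain ⟨t, -, htf, htK⟩ := K.isCompact.finite_cover_balls he
  set m : ℤ := ⌈|C| / e⌉ + 1
  have hfloor : ∀ i p, ⌊q i p / e⌋ ∈ Finset.Icc (-m) m := by
    intro i p
    have h1 : |q i p / e| ≤ |C| / e := by
      rw [abs_div, abs_of_pos he]
      exact div_le_div_of_nonneg_right ((hqC i p).trans (le_abs_self C)) he.le
    rw [abs_le] at h1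
    have h2 := Int.le_ceil (|C| / e)
    rw [Finset.mem_Icc]
    constructor
    · rw [Int.le_floor]
      push_cast [m]
      linarith
    · have h3 := Int.floor_le (q i p / e)
      have : ((⌊q i p / e⌋ : ℤ) : ℝ) ≤ (m : ℝ) := by
        push_cast [m]
        linarith
      exact_mod_cast this
  have hidx : ∀ x : (L1loc.restrict K '' range fun i => L1loc.mk (ρ i) (hρ i)),
      ∃ i, L1loc.restrict K (L1loc.mk (ρ i) (hρ i)) = x := by
    rintro ⟨x, -, ⟨i, rfl⟩, hx⟩
    exact ⟨i, hx⟩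
  choose idx hidx using hidx
  have := htf.fintype
  refine ⟨t → Finset.Icc (-m) m, inferInstance,
    fun x p => ⟨⌊q (idx x) p / e⌋, hfloor _ _⟩, fun x y hxy => ?_⟩
  rw [← hidx x, ← hidx y, L1loc.dist_restrict_mk]
  set i := idx x
  set j := idx y
  have hclose : ∀ z ∈ (K : Set (E d)), |q i z - q j z| ≤ (2 * L + 1) * e := by
    intro z hz
    obtain ⟨p, hp, hzp⟩ := mem_iUnion₂.1 (htK hz)
    have hfl : ⌊q i p / e⌋ = ⌊q j p / e⌋ := congrArg Subtype.val (congrFun hxy ⟨p, hp⟩)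
    have h1 : |q i p - q j p| ≤ e := by
      have := (Int.abs_sub_lt_one_of_floor_eq_floor hfl).le
      rwa [← sub_div, abs_div, abs_of_pos he, div_le_one he] at this
    have h2 : ∀ i, |q i z - q i p| ≤ L * e := fun i => by
      have := (hqL i).dist_le_mul z p
      rw [Real.dist_eq] at this
      exact this.trans (mul_le_mul_of_nonneg_left (mem_ball.1 hzp).le (NNReal.coe_nonneg L))
    have h3 := h2 i
    have h4 := h2 j
    rw [abs_le] at h1 h3 h4 ⊢
    constructor <;> linarith
  have hKfin : IsFiniteMeasure (volume.restrict (K : Set (E d))) :=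
    ⟨by simpa using K.isCompact.measure_lt_top⟩
  have hqi : ∀ i, Integrable (q i) (volume.restrict (K : Set (E d))) := fun i =>
    (hqL i).continuous.continuousOn.integrableOn_compact K.isCompact
  have hρi : ∀ i, Integrable (ρ i) (volume.restrict (K : Set (E d))) := fun i =>
    (hρ i).integrableOn_isCompact K.isCompact
  have hi1 := ((hρi i).sub (hqi i)).abs
  have hi2 := ((hρi j).sub (hqi j)).abs
  have hi3 : Integrable (fun _ : E d => (2 * L + 1) * e) (volume.restrict (K : Set (E d))) :=
    integrable_const _
  calc ∫ z in (K : Set (E d)), |ρ i z - ρ j z|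
      ≤ ∫ z in (K : Set (E d)), (|ρ i z - q i z| + |ρ j z - q j z| + (2 * L + 1) * e) := by
        refine setIntegral_mono_on ((hρi i).sub (hρi j)).abs ((hi1.add hi2).add hi3)
          K.isCompact.measurableSet fun z hz => ?_
        have h1 := hclose z hz
        have h2 : ρ i z - ρ j z = (ρ i z - q i z) - (ρ j z - q j z) + (q i z - q j z) := by ring
        rw [h2]
        exact (abs_add_le _ _).trans (add_le_add (abs_sub _ _) h1)
    _ = (∫ z in (K : Set (E d)), |ρ i z - q i z|) + (∫ z in (K : Set (E d)), |ρ j z - q j z|) +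
          V * ((2 * L + 1) * e) := by
        have e1 := integral_add (hi1.add hi2) hi3
        have e2 := integral_add hi1 hi2
        simp only [Pi.add_apply] at e1
        rw [setIntegral_const, smul_eq_mul] at e1
        exact e1.trans (congrArg (· + _) e2)
    _ ≤ ε / 4 + ε / 4 + ε / 4 := by
        gcongr
        · exact hqρ i
        · exact hqρ j
        · rw [show V * ((2 * (L : ℝ) + 1) * e) = ε / 4 * (V / (V + 1)) by
            simp only [e]
            field_simp]
          refine mul_le_of_le_one_right (by positivity) ?_
          rw [div_le_one (by positivity)]
          linarith
    _ < ε := by linarith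

/-! ### Velocity moments and conclusion. -/

theorem integrable_mul_weight {f : E d × E d → ℝ} (hf : LocallyIntegrable f volume) {Ψ : E d → ℝ}
    (hΨ : Continuous Ψ) (hΨc : HasCompactSupport Ψ) {A : Set (E d)} (hA : IsCompact A) :
    Integrable (fun z => f z * Ψ z.2) ((volume.restrict A).prod volume) := by
  have hprod : (volume.restrict A).prod (volume : Measure (E d)) =
      (volume : Measure (E d × E d)).restrict (A ×ˢ univ) := by
    rw [Measure.volume_eq_prod, ← Measure.prod_restrict, Measure.restrict_univ]
  rw [hprod]
  have hK : IsCompact (A ×ˢ tsupport Ψ) := hA.prod hΨc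
  obtain ⟨S, hS⟩ := hΨc.exists_bound_of_continuous hΨ
  have h1 : IntegrableOn (fun z => f z * Ψ z.2) (A ×ˢ tsupport Ψ) volume :=
    Integrable.mul_bdd (c := S) (hf.integrableOn_isCompact hK)
      (hΨ.comp continuous_snd).aestronglyMeasurable (Eventually.of_forall fun z => hS _)
  refine h1.of_forall_sdiff_eq_zero (hA.measurableSet.prod MeasurableSet.univ) fun z hz => ?_
  have : z.2 ∉ tsupport Ψ := fun h => hz.2 ⟨hz.1.1, h⟩
  rw [image_eq_zero_of_notMem_tsupport this, mul_zero]

theorem integrableOn_moment {f : E d × E d → ℝ} (hf : LocallyIntegrable f volume) {Ψ : E d → ℝ}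
    (hΨ : Continuous Ψ) (hΨc : HasCompactSupport Ψ) {A : Set (E d)} (hA : IsCompact A) :
    IntegrableOn (moment f Ψ) A volume :=
  (integrable_mul_weight hf hΨ hΨc hA).integral_prod_left

theorem locallyIntegrable_moment {f : E d × E d → ℝ} (hf : LocallyIntegrable f volume)
    {Ψ : E d → ℝ} (hΨ : Continuous Ψ) (hΨc : HasCompactSupport Ψ) :
    LocallyIntegrable (moment f Ψ) volume := fun x =>
  ⟨closedBall x 1, closedBall_mem_nhds x one_pos,
    integrableOn_moment hf hΨ hΨc (isCompact_closedBall x 1)⟩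

theorem integral_abs_moment_sub_le {f u : E d × E d → ℝ} (hf : LocallyIntegrable f volume)
    (hu : LocallyIntegrable u volume) {Ψ : E d → ℝ} (hΨ : Continuous Ψ)
    (hΨc : HasCompactSupport Ψ) {A : Set (E d)} (hA : IsCompact A) {R S : ℝ}
    (hAR : A ⊆ closedBall 0 R) (hΨR : ∀ v, R < ‖v‖ → Ψ v = 0) (hS : ∀ v, |Ψ v| ≤ S) :
    ∫ x in A, |moment f Ψ x - moment u Ψ x| ≤ S * ∫ z in closedBall 0 R, |f z - u z| := by
  have hS0 : 0 ≤ S := (abs_nonneg _).trans (hS 0)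
  have hif := integrable_mul_weight hf hΨ hΨc hA
  have hiu := integrable_mul_weight hu hΨ hΨc hA
  have hid : Integrable (fun z => (f z - u z) * Ψ z.2) ((volume.restrict A).prod volume) := by
    refine (hif.sub hiu).congr (Eventually.of_forall fun z => ?_)
    simp only [Pi.sub_apply]
    ring
  have hB : IntegrableOn (fun z => |f z - u z|) (closedBall 0 R) volume :=
    ((hf.sub hu).integrableOn_isCompact (isCompact_closedBall _ _)).abs
  have hmeas : (volume.restrict A).prod (volume : Measure (E d)) =
      (volume : Measure (E d × E d)).restrict (A ×ˢ univ) := by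
    rw [Measure.volume_eq_prod, ← Measure.prod_restrict, Measure.restrict_univ]
  calc ∫ x in A, |moment f Ψ x - moment u Ψ x|
      ≤ ∫ x in A, ∫ v, |(f (x, v) - u (x, v)) * Ψ v| := by
        refine integral_mono_of_nonneg (Eventually.of_forall fun x => abs_nonneg _)
          hid.abs.integral_prod_left ?_
        filter_upwards [hif.prod_right_ae, hiu.prod_right_ae] with x h1 h2
        have : moment f Ψ x - moment u Ψ x = ∫ v, (f (x, v) - u (x, v)) * Ψ v := by
          simp only [moment]
          rw [← integral_sub h1 h2]
          simp only [sub_mul]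
        rw [this]
        exact abs_integral_le_integral_abs
    _ = ∫ z in A ×ˢ univ, |(f z - u z) * Ψ z.2| := by
        rw [← hmeas, integral_prod _ hid.abs]
    _ = ∫ z, (A ×ˢ univ).indicator (fun z => |(f z - u z) * Ψ z.2|) z :=
        (integral_indicator (hA.measurableSet.prod MeasurableSet.univ)).symm
    _ ≤ ∫ z, (closedBall 0 R).indicator (fun z => S * |f z - u z|) z := by
        refine integral_mono_of_nonneg
          (Eventually.of_forall fun z => indicator_nonneg (fun _ _ => abs_nonneg _) _)
          ((integrable_indicator_iff measurableSet_closedBall).2 (hB.const_mul S))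
          (Eventually.of_forall fun z => ?_)
        have hpos : 0 ≤ (closedBall (0 : E d × E d) R).indicator (fun z => S * |f z - u z|) z :=
          indicator_nonneg (fun _ _ => by positivity) _
        by_cases hz : z ∈ A ×ˢ (univ : Set (E d))
        · simp only [indicator_of_mem hz]
          by_cases hzR : R < ‖z.2‖
          · simpa [hΨR _ hzR] using hpos
          · have hzB : z ∈ closedBall (0 : E d × E d) R := by
              rw [mem_closedBall_zero_iff]
              exact max_le (by simpa using hAR hz.1) (not_lt.1 hzR)
            rw [indicator_of_mem hzB, abs_mul, mul_comm]
            exact mul_le_mul_of_nonneg_right (hS _) (abs_nonneg _)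
        · simp only [indicator_of_notMem hz]
          exact hpos
    _ = S * ∫ z in closedBall 0 R, |f z - u z| := by
        rw [integral_indicator measurableSet_closedBall, integral_const_mul]

/-- Multiplying `Ψ` by a spatial cutoff equal to 1 on `K` gives a weight `θ` with compact support in
phase space, without changing the moments on `K`. Half of `ε` pays for replacing `f i` by `u`, the
other half for the Lipschitz approximation. -/
theorem exists_lipschitz_approximation_moment {ι : Type*} {F : E d → E d} {L : ℝ≥0}
    (hF : LipschitzWith L F) {f g : ι → E d × E d → ℝ} (hf : LocallyEquiintegrable f)
    (hfg : ∀ i, HasWeakTransport F (f i) (g i)) (hg : BoundedInL1loc g) {Ψ : E d → ℝ}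
    (hΨ : ContDiff ℝ 1 Ψ) (hΨc : HasCompactSupport Ψ) {K : Set (E d)} (hK : IsCompact K) {ε : ℝ}
    (hε : 0 < ε) :
    ∃ (C : ℝ) (Λ : ℝ≥0), ∀ i, ∃ q : E d → ℝ, (∀ x, |q x| ≤ C) ∧ LipschitzWith Λ q ∧
      ∫ x in K, |moment (f i) Ψ x - q x| ≤ ε := by
  obtain ⟨RΨ, hRΨ, hΨ0⟩ := exists_radius_of_hasCompactSupport hΨc
  obtain ⟨S, hS⟩ := hΨc.exists_bound_of_continuous hΨ.continuous
  have hS0 : 0 ≤ S := (norm_nonneg _).trans (hS 0)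
  obtain ⟨RK, hRK0, hRK⟩ : ∃ RK : ℝ, 0 < RK ∧ K ⊆ closedBall 0 RK := by
    obtain ⟨r, hr⟩ := hK.isBounded.subset_closedBall (0 : E d)
    exact ⟨max r 1, by positivity, hr.trans (closedBall_subset_closedBall (le_max_left _ _))⟩
  let χ : ContDiffBump (0 : E d) := ⟨RK, RK + 1, hRK0, by linarith⟩
  set R : ℝ := max (RK + 1) RΨ
  set θ : E d × E d → ℝ := fun z => χ z.1 * Ψ z.2
  have hθ : ContDiff ℝ 1 θ := (χ.contDiff.comp contDiff_fst).mul (hΨ.comp contDiff_snd)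
  have hΨR : ∀ v, R < ‖v‖ → Ψ v = 0 := fun v hv => hΨ0 v ((le_max_right _ _).trans_lt hv)
  have hθR : ∀ z, R < ‖z‖ → θ z = 0 := by
    intro z hz
    rcases lt_max_iff.1 (show R < max ‖z.1‖ ‖z.2‖ from hz) with h | h
    · have : χ z.1 = 0 := χ.zero_of_le_dist (by
        rw [dist_zero_right]
        exact ((le_max_left _ _).trans_lt h).le)
      simp [θ, this]
    · simp [θ, hΨR _ h]
  have hKR : K ⊆ closedBall 0 R :=
    hRK.trans (closedBall_subset_closedBall ((by linarith : RK ≤ RK + 1).trans (le_max_left _ _)))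
  obtain ⟨M, G, hM0, hG0, happ⟩ := exists_bounded_approximation hF hf hfg hg R
    -- Passing to moments multiplies the error by `S`, which may vanish; hence `S + 1`.
    (show 0 < ε / (2 * (S + 1)) by positivity)
  obtain ⟨C, Λ, hlip⟩ := exists_lipschitz_approximation hF.continuous hθ hθR hM0 hG0 (half_pos hε)
  refine ⟨C, Λ, fun i => ?_⟩
  obtain ⟨u, hu, hM, hG, hfu⟩ := happ i
  obtain ⟨q, hqC, hqL, hqi, hq⟩ := hlip u hu hM hG
  refine ⟨q, hqC, hqL, ?_⟩
  have hul : LocallyIntegrable u volume := hu.continuous.locallyIntegrable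
  have hmom : ∀ x ∈ K, ∫ v, u (x, v) * θ (x, v) = moment u Ψ x := by
    intro x hx
    have : χ x = 1 := χ.one_of_mem_closedBall (hRK hx)
    simp [moment, θ, this]
  have hi1 : IntegrableOn (fun x => |moment (f i) Ψ x - moment u Ψ x|) K volume :=
    ((integrableOn_moment (hf.1.1 i) hΨ.continuous hΨc hK).sub
      (integrableOn_moment hul hΨ.continuous hΨc hK)).abs
  calc ∫ x in K, |moment (f i) Ψ x - q x|
      ≤ ∫ x in K, (|moment (f i) Ψ x - moment u Ψ x| +
          |(∫ v, u (x, v) * θ (x, v)) - q x|) := by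
        refine integral_mono_of_nonneg (Eventually.of_forall fun x => abs_nonneg _)
          (hi1.add hqi.abs.integrableOn) ?_
        filter_upwards [ae_restrict_mem hK.measurableSet] with x hx
        rw [hmom x hx]
        exact abs_sub_le _ _ _
    _ = (∫ x in K, |moment (f i) Ψ x - moment u Ψ x|) +
          ∫ x in K, |(∫ v, u (x, v) * θ (x, v)) - q x| :=
        integral_add hi1 hqi.abs.integrableOn
    _ ≤ S * (ε / (2 * (S + 1))) + ε / 2 := by
        refine add_le_add ((integral_abs_moment_sub_le (hf.1.1 i) hul hΨ.continuous hΨc hK hKR hΨR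
          hS).trans (mul_le_mul_of_nonneg_left hfu hS0)) ?_
        exact (setIntegral_le_integral hqi.abs (Eventually.of_forall fun x => abs_nonneg _)).trans hq
    _ ≤ ε := by
        have : S * (ε / (2 * (S + 1))) ≤ ε / 2 := by
          rw [mul_div_assoc', div_le_div_iff₀ (by positivity) (by norm_num)]
          nlinarith
        linarith

end KineticAveraging

end

theorem mainTheorem3 {d : ℕ} (hd : 1 ≤ d)
    (F : KineticAveraging.E d → KineticAveraging.E d) (hF : KineticAveraging.MemW1Infty F)
    {ι : Type*} (f g : ι → KineticAveraging.E d × KineticAveraging.E d → ℝ)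
    (hf : KineticAveraging.LocallyEquiintegrable f)
    (hfg : ∀ i, KineticAveraging.HasWeakTransport F (f i) (g i))
    (hg : KineticAveraging.BoundedInL1loc g)
    (Ψ : KineticAveraging.E d → ℝ) (hΨ : ContDiff ℝ 1 Ψ) (hΨc : HasCompactSupport Ψ) :
    ∃ hρ : ∀ i, LocallyIntegrable (KineticAveraging.moment (f i) Ψ) volume,
      IsCompact (closure (range fun i =>
        KineticAveraging.L1loc.mk (KineticAveraging.moment (f i) Ψ) (hρ i))) := by
  obtain ⟨F', L, hL, hFF'⟩ := hF.exists_lipschitz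
  have hρ : ∀ i, LocallyIntegrable (KineticAveraging.moment (f i) Ψ) volume := fun i =>
    KineticAveraging.locallyIntegrable_moment (hf.1.1 i) hΨ.continuous hΨc
  refine ⟨hρ, KineticAveraging.L1loc.isCompact_closure fun K => ?_⟩
  exact KineticAveraging.totallyBounded_of_lipschitz_approximation K hρ fun ε hε =>
    KineticAveraging.exists_lipschitz_approximation_moment hL hf
      (fun i => (hfg i).congr_force hFF') hg hΨ hΨc K.isCompact hε
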